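/- Let $0\le a<b\le\pi$ with $[a,b]\neq[0,\pi]$, and put $\theta=\frac{b-a}{2}\in(0,\pi/2)$, $\xi=e^{i(a+\theta)}$, $\mathbb H=\{z\in\mathbb C:\operatorname{Im}z>0\}$ and $\Delta(\theta)=\dfrac1{\sqrt{4+\tan^2\theta}}$. Call real sequences $(a_k),(\gamma_k),(\epsilon_k),(\theta_k)$, $k\ge1$, admissible if, for all $k\ge 1$, $$a_k>0,\quad \gamma_k>0,\quad \epsilon_k>0,\quad \pi\epsilon_k\le\theta,\quad \lim_{j\to\infty}\epsilon_j=0,\qquad \theta_{2k}+\pi\epsilon_{2k}=\theta,\quad \theta_{2k-1}-\pi\epsilon_{2k-1}=-\theta,$$ $$\sum_{l=1}^\infty\frac{a_l}{\gamma_l^{\epsilon_l}}\le\frac{\gamma_1}{2}\ \text{ (in particular the series converges)},\qquad \gamma_1\ge2,\qquad \gamma_{k+1}>\gamma_k^2,$$ $$\sum_{l=1}^{k-1}\frac{a_l}{\gamma_k^{\epsilon_l}}\le\frac{\Delta(\theta)a_k}{2k\gamma_k^{2\epsilon_k}},\qquad \sum_{l=k+1}^{\infty}\frac{a_l}{\gamma_l^{\epsilon_l}}\le\frac{\Delta(\theta)a_k}{2k\gamma_k^{2\epsilon_k}}.$$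 Then admissible sequences exist. Moreover, for any admissible sequences, with $F(z)=z+\sum_{k=1}^\infty \dfrac{a_ke^{i\theta_k}}{(z+\gamma_k)^{\epsilon_k}}$ (principal branch of the powers), the following holds. For every $z\in\mathbb H$ the series defining $F(\overline{\xi}z)$ converges, and $f(z)=\xi F(\overline{\xi}z)$ defines a holomorphic map $f\colon\mathbb H\to\mathbb H$ such that: 1. the Denjoy–Wolff point of $f$ is $\infty$, i.e. $f^n\to\infty$ locally uniformly on $\mathbb H$, and $f$ is parabolic, i.e. $f(z)/z$ has angular limit $1$ at $\infty$ (limit as $|z|\to\infty$ in each sector $\delta<\arg z<\pi-\delta$, $\delta>0$); 2. $f$ has zero hyperbolic step: the hyperbolic distance between $f^{n+1}(z)$ and $f^n(z)$ tends to $0$ for every $z\in\mathbb H$; 3. for every $z\in\mathbb H$, the set $\mathrm{Slope}[f,z]$ of all $s\in[0,\pi]$ for which there is a subsequence of the orbit with $\arg f^{n_k}(z)\to s$ equals $[a,b]$; 4. let $z_0=\xi\gamma_1/2\in\mathbb H$, and for $k\ge1$ let $N_k$ be the least $n$ with $\operatorname{Re}(\overline{\xi}f^n(z_0))>\gamma_k^2$.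 Then each $N_k$ exists, $(N_k)_{k\ge 1}$ is strictly increasing, and $\arg f^{N_{2k}}(z_0)\to b$, $\arg f^{N_{2k+1}}(z_0)\to a$ as $k\to\infty$. -/

import Mathlib

open Filter Topology UpperHalfPlane
open scoped Real Manifold

noncomputable section

/-- Infinity is the Denjoy-Wolff point of `f : ℍ → ℍ`: the iterates of `f` converge to infinity,
uniformly on compact subsets of the upper half-plane. -/
def HasDenjoyWolffInfty (f : ℍ → ℍ) : Prop :=
  ∀ K : Set ℍ, IsCompact K → ∀ R : ℝ, ∀ᶠ n : ℕ in atTop, ∀ z ∈ K, R < ‖((f^[n] z : ℍ) : ℂ)‖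

/-- The function `g` has angular (non-tangential) limit `α` at infinity: in every sector
`{δ < arg z < π - δ}`, `δ > 0`, the values `g z` tend to `α` as `|z| → ∞`. -/
def HasAngularLimitInfty (g : ℍ → ℂ) (α : ℂ) : Prop :=
  ∀ δ : ℝ, 0 < δ →
    Tendsto g
      (comap (fun z : ℍ => ‖(z : ℂ)‖) atTop ⊓
        𝓟 {z : ℍ | δ < Complex.arg (z : ℂ) ∧ Complex.arg (z : ℂ) < π - δ})
      (𝓝 α)

/-- `f` is a parabolic holomorphic self-map of the upper half-plane with Denjoy-Wolff point
infinity: the angular limit of `f z / z` at infinity is `1`. -/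
structure IsParabolicInfty (f : ℍ → ℍ) : Prop where
  holomorphic : MDifferentiable 𝓘(ℂ) 𝓘(ℂ) f
  denjoyWolff : HasDenjoyWolffInfty f
  angular : HasAngularLimitInfty (fun z => (f z : ℂ) / (z : ℂ)) 1

/-- `f` has zero hyperbolic step; `dist` on `ℍ` is the hyperbolic distance. -/
def HasZeroHyperbolicStep (f : ℍ → ℍ) : Prop :=
  ∀ z : ℍ, Tendsto (fun n : ℕ => dist (f^[n + 1] z) (f^[n] z)) atTop (𝓝 0)

/-- The set of slopes of `f` at the starting point `z`. -/
def slopeSet (f : ℍ → ℍ) (z : ℍ) : Set ℝ :=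
  {s | s ∈ Set.Icc 0 π ∧ ∃ φ : ℕ → ℕ, StrictMono φ ∧
    Tendsto (fun k => Complex.arg ((f^[φ k] z : ℍ) : ℂ)) atTop (𝓝 s)}

/-- Four real sequences `a_k`, `γ_k`, `ε_k`, `θ_k`. Only the indices `k ≥ 1` are ever used
(the values at `0` are irrelevant). -/
structure SlopeCoeffs where
  a : ℕ → ℝ
  γ : ℕ → ℝ
  ε : ℕ → ℝ
  ϑ : ℕ → ℝ

namespace SlopeCoeffs

/-- The constant `Δ(θ) = 1 / √(4 + tan² θ)`. -/
def Δ (θ : ℝ) : ℝ := 1 / √(4 + Real.tan θ ^ 2)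

/-- The growth conditions on the coefficients relative to the angle `θ`. -/
structure Admissible (c : SlopeCoeffs) (θ : ℝ) : Prop where
  a_pos : ∀ k, 1 ≤ k → 0 < c.a k
  γ_pos : ∀ k, 1 ≤ k → 0 < c.γ k
  ε_pos : ∀ k, 1 ≤ k → 0 < c.ε k
  ε_le : ∀ k, 1 ≤ k → π * c.ε k ≤ θ
  ε_lim : Tendsto c.ε atTop (𝓝 0)
  angle_even : ∀ k, 1 ≤ k → c.ϑ (2 * k) + π * c.ε (2 * k) = θ
  angle_odd : ∀ k, 1 ≤ k → c.ϑ (2 * k - 1) - π * c.ε (2 * k - 1) = -θ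
  step_summable : Summable fun l : ℕ => c.a (l + 1) / c.γ (l + 1) ^ c.ε (l + 1)
  step : ∑' l : ℕ, c.a (l + 1) / c.γ (l + 1) ^ c.ε (l + 1) ≤ c.γ 1 / 2
  γ_one : 2 ≤ c.γ 1
  γ_growth : ∀ k, 1 ≤ k → c.γ k ^ 2 < c.γ (k + 1)
  head_le : ∀ k, 1 ≤ k →
    ∑ l ∈ Finset.Ico 1 k, c.a l / c.γ k ^ c.ε l
      ≤ Δ θ * c.a k / (2 * k * c.γ k ^ (2 * c.ε k))
  tail_le : ∀ k, 1 ≤ k →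
    ∑' l : ℕ, c.a (k + 1 + l) / c.γ (k + 1 + l) ^ c.ε (k + 1 + l)
      ≤ Δ θ * c.a k / (2 * k * c.γ k ^ (2 * c.ε k))

/-- `p_k(z) = a_k e^{iθ_k} / (z + γ_k)^{ε_k}`, with the principal branch of the power. -/
def term (c : SlopeCoeffs) (k : ℕ) (z : ℂ) : ℂ :=
  (c.a k : ℂ) * Complex.exp (Complex.I * (c.ϑ k : ℂ)) / (z + (c.γ k : ℂ)) ^ (c.ε k : ℂ)

/-- `F(z) = z + ∑_{k ≥ 1} p_k(z)`. -/
def F (c : SlopeCoeffs) (z : ℂ) : ℂ := z + ∑' k : ℕ, c.term (k + 1) z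

end SlopeCoeffs

/-- The rotation `ξ = e^{i(a + θ)}`, where `θ = (b - a) / 2`. -/
def slopeRotation (a b : ℝ) : ℂ := Complex.exp (Complex.I * ((a + (b - a) / 2 : ℝ) : ℂ))

/-- The first `n` such that the `n`-th point of the orbit of `z`, rotated back by the conjugate
of `ξ`, has real part larger than `γ_k ^ 2`. -/
def exitTime (c : SlopeCoeffs) (ξ : ℂ) (f : ℍ → ℍ) (z : ℍ) (k : ℕ) : ℕ :=
  sInf {n : ℕ | c.γ k ^ 2 < (starRingEnd ℂ ξ * ((f^[n] z : ℍ) : ℂ)).re}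

end

/-! Write `D = F - id` for the displacement. Every summand of `D` lies in the closed sector
`|arg| ≤ θ`, hence so does `D`; therefore `f` does not decrease imaginary parts, and along an orbit
`w` of `F` the real parts increase. They increase to `∞`, since the first summand is bounded below
on bounded sets. The normal convergence of the series then gives `D (w n) → 0`, and as the imaginary
parts of the orbit of `f` stay away from `0`, the hyperbolic steps tend to `0`.

While `γ_k ≤ Re w n ≤ γ_k ^ 2`, the growth conditions make the `k`-th summand dominate `D (w n)`,
and this summand is almost parallel to the edge `arg = (-1) ^ k θ` of the sector. The passage from
`γ_k` to `γ_k ^ 2` is so long that on leaving this window the slope `Im w n / Re w n` has come close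
to `(-1) ^ k tan θ`. Hence `θ` and `-θ` are both limits of `arg (w n)`; since the increments of
`arg (w n)` tend to `0`, all intermediate values are limits as well.
-/

lemma ordConnected_setOf_mapClusterPt {x : ℕ → ℝ}
    (hx : Tendsto (fun n => x (n + 1) - x n) atTop (𝓝 0)) :
    {s | MapClusterPt s atTop x}.OrdConnected := by
  refine ⟨fun a ha b hb s hs => ?_⟩
  rcases hs.1.eq_or_lt with rfl | has
  · exact ha
  rcases hs.2.eq_or_lt with rfl | hsb
  · exact hb
  refine mapClusterPt_iff_frequently.2 fun u hu => ?_
  obtain ⟨δ, hδ, hball⟩ := Metric.mem_nhds_iff.1 hu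
  obtain ⟨N, hN⟩ := eventually_atTop.1 (Metric.tendsto_nhds.1 hx δ hδ)
  refine frequently_atTop.2 fun M => ?_
  obtain ⟨n₁, hn₁, h₁⟩ := frequently_atTop.1
    (mapClusterPt_iff_frequently.1 ha _ (Iio_mem_nhds has)) (max M N)
  obtain ⟨n₂, hn₂, h₂⟩ := frequently_atTop.1
    (mapClusterPt_iff_frequently.1 hb _ (Ioi_mem_nhds hsb)) n₁
  obtain ⟨j, hj, hlt, hge⟩ : ∃ j, n₁ ≤ j ∧ x j < s ∧ s ≤ x (j + 1) := by
    by_contra! hstay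
    have hbelow : ∀ j, n₁ ≤ j → x j < s := fun j hj => by
      induction j, hj using Nat.le_induction with
      | base => exact h₁
      | succ j hj ih => exact hstay j hj ih
    exact lt_asymm (hbelow n₂ hn₂) h₂
  refine ⟨j + 1, by omega, hball ?_⟩
  have hstep := hN j (by omega)
  rw [Real.dist_eq, sub_zero, abs_lt] at hstep
  rw [Metric.mem_ball, Real.dist_eq, abs_lt]
  constructor <;> linarith

lemma le_add_mul_sub_of_step {x g : ℕ → ℝ} (hx : Monotone x) {A η : ℝ} (hη : 0 ≤ η)
    (h0 : g 0 ≤ A) {N : ℕ}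
    (hstep : ∀ n < N, g (n + 1) ≤ A ∨ g (n + 1) - g n ≤ η * (x (n + 1) - x n)) :
    g N ≤ A + η * (x N - x 0) := by
  induction N with
  | zero => simpa using h0
  | succ n ih =>
    rcases hstep n n.lt_succ_self with hsmall | hinc
    · linarith [mul_nonneg hη (sub_nonneg.2 (hx (Nat.zero_le (n + 1))))]
    · linarith [ih fun j hj => hstep j (hj.trans n.lt_succ_self)]

lemma tendsto_atTop_of_monotone_of_comp {x : ℕ → ℝ} (hx : Monotone x) {N : ℕ → ℕ}
    (h : Tendsto (fun k => x (N k)) atTop atTop) : Tendsto N atTop atTop :=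
  tendsto_atTop.2 fun n =>
    (h.eventually_gt_atTop (x n)).mono fun _ hk => (hx.reflect_lt hk).le

/-- The closed sector `|arg v| ≤ arctan t` about the positive real axis. -/
def slopeSector (t : ℝ) : AddSubmonoid ℂ where
  carrier := {v | |v.im| ≤ t * v.re}
  zero_mem' := by simp
  add_mem' {u v} hu hv := by
    calc |(u + v).im| ≤ |u.im| + |v.im| := abs_add_le _ _
      _ ≤ t * u.re + t * v.re := add_le_add hu hv
      _ = t * (u + v).re := by rw [Complex.add_re, mul_add]

/-- The functional `t · Re v - s · Im v`. For `s = ±1` it measures how far `v` lies from the edge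
`Im v = s t · Re v` of the sector `slopeSector t`, on which it is nonnegative. -/
noncomputable def sectorGap (t s : ℝ) : ℂ →L[ℝ] ℝ := t • Complex.reCLM - s • Complex.imCLM

lemma sectorGap_apply (t s : ℝ) (v : ℂ) : sectorGap t s v = t * v.re - s * v.im := rfl

section SlopeSector

variable {t s : ℝ} {v : ℂ}

lemma mem_slopeSector : v ∈ slopeSector t ↔ |v.im| ≤ t * v.re := Iff.rfl

lemma isClosed_slopeSector (t : ℝ) : IsClosed (slopeSector t : Set ℂ) :=
  isClosed_le Complex.continuous_im.abs (Complex.continuous_re.const_mul t)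

lemma re_nonneg_of_mem_slopeSector (ht : 0 < t) (hv : v ∈ slopeSector t) : 0 ≤ v.re :=
  nonneg_of_mul_nonneg_right ((abs_nonneg _).trans hv) ht

lemma norm_le_of_mem_slopeSector (ht : 0 < t) (hv : v ∈ slopeSector t) :
    ‖v‖ ≤ (1 + t) * v.re :=
  calc ‖v‖ ≤ |v.re| + |v.im| := Complex.norm_le_abs_re_add_abs_im v
    _ ≤ v.re + t * v.re := by
      rw [abs_of_nonneg (re_nonneg_of_mem_slopeSector ht hv)]
      exact add_le_add_right hv _
    _ = (1 + t) * v.re := by ring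

lemma abs_sectorGap_le (ht : 0 ≤ t) (hs : |s| ≤ 1) (v : ℂ) :
    |sectorGap t s v| ≤ (1 + t) * ‖v‖ :=
  calc |sectorGap t s v| ≤ |t * v.re| + |s * v.im| := abs_sub _ _
    _ = t * |v.re| + |s| * |v.im| := by rw [abs_mul, abs_mul, abs_of_nonneg ht]
    _ ≤ t * ‖v‖ + 1 * ‖v‖ := by
      gcongr
      exacts [Complex.abs_re_le_norm v, Complex.abs_im_le_norm v]
    _ = (1 + t) * ‖v‖ := by ring

lemma sectorGap_tan_mul_exp {θ : ℝ} (hθ : Real.cos θ ≠ 0) (hs : |s| = 1) (r ψ : ℝ) :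
    sectorGap (Real.tan θ) s (r * Complex.exp (ψ * Complex.I)) =
      r * Real.sin (θ - s * ψ) / Real.cos θ := by
  rw [sectorGap_apply, Complex.re_ofReal_mul, Complex.im_ofReal_mul, Complex.exp_ofReal_mul_I_re,
    Complex.exp_ofReal_mul_I_im, Real.tan_eq_sin_div_cos, Real.sin_sub]
  rcases eq_or_eq_neg_of_abs_eq hs with rfl | rfl
  · field_simp
  · rw [neg_one_mul, neg_one_mul, Real.cos_neg, Real.sin_neg]
    field_simp

lemma mul_exp_mem_slopeSector {r θ ψ : ℝ} (hr : 0 ≤ r) (hθ : θ < π / 2) (hψ : |ψ| ≤ θ) :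
    (r * Complex.exp (ψ * Complex.I) : ℂ) ∈ slopeSector (Real.tan θ) := by
  have hcos : 0 < Real.cos θ := Real.cos_pos_of_mem_Ioo ⟨by linarith [abs_nonneg ψ], hθ⟩
  have hgap : ∀ s : ℝ, |s| = 1 →
      0 ≤ sectorGap (Real.tan θ) s (r * Complex.exp (ψ * Complex.I)) := fun s hs => by
    have hsψ : |s * ψ| ≤ θ := by rwa [abs_mul, hs, one_mul]
    rw [sectorGap_tan_mul_exp hcos.ne' hs]
    have hsin : 0 ≤ Real.sin (θ - s * ψ) :=
      Real.sin_nonneg_of_nonneg_of_le_pi (by linarith [abs_le.1 hsψ]) (by linarith [abs_le.1 hsψ])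
    positivity
  have h₁ := hgap 1 abs_one
  have h₂ := hgap (-1) (by rw [abs_neg, abs_one])
  rw [sectorGap_apply] at h₁ h₂
  exact mem_slopeSector.2 (abs_le.2 ⟨by linarith, by linarith⟩)

end SlopeSector

/-- Paths in the plane all of whose steps lie in the sector `slopeSector t`. -/
def IsSectorPath (t : ℝ) (w : ℕ → ℂ) : Prop := ∀ n, w (n + 1) - w n ∈ slopeSector t

namespace IsSectorPath

variable {t : ℝ} {w : ℕ → ℂ}

lemma sub_mem (hw : IsSectorPath t w) {m n : ℕ} (h : m ≤ n) : w n - w m ∈ slopeSector t := by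
  induction n, h using Nat.le_induction with
  | base => simpa only [sub_self] using (slopeSector t).zero_mem
  | succ n _ ih => simpa only [sub_add_sub_cancel] using (slopeSector t).add_mem (hw n) ih

lemma monotone_re (ht : 0 < t) (hw : IsSectorPath t w) : Monotone fun n => (w n).re :=
  monotone_nat_of_le_succ fun n =>
    sub_nonneg.1 (by simpa using re_nonneg_of_mem_slopeSector ht (hw n))

lemma norm_le (ht : 0 < t) (hw : IsSectorPath t w) {X : ℝ} (h0 : ‖w 0‖ ≤ X) {n : ℕ}
    (hn : (w n).re ≤ X) : ‖w n‖ ≤ (3 + 2 * t) * X := by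
  have hre := (abs_le.1 (Complex.abs_re_le_norm (w 0))).1
  calc ‖w n‖ ≤ ‖w n - w 0‖ + ‖w 0‖ := by simpa using norm_add_le (w n - w 0) (w 0)
    _ ≤ (1 + t) * (w n - w 0).re + X :=
      add_le_add (norm_le_of_mem_slopeSector ht (hw.sub_mem n.zero_le)) h0
    _ ≤ (1 + t) * (2 * X) + X := by
      rw [Complex.sub_re]
      gcongr
      linarith
    _ = (3 + 2 * t) * X := by ring

lemma abs_im_div_re_le (ht : 0 < t) (hw : IsSectorPath t w) {n : ℕ} (hn : 0 < (w n).re) :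
    |(w n).im / (w n).re| ≤ t + (1 + t) * ‖w 0‖ / (w n).re := by
  have hsub := mem_slopeSector.1 (hw.sub_mem n.zero_le)
  have him : |(w n).im| ≤ |(w n - w 0).im| + |(w 0).im| := by
    simpa using abs_add_le (w n - w 0).im (w 0).im
  rw [Complex.sub_re] at hsub
  rw [abs_div, abs_of_pos hn, div_le_iff₀ hn, add_mul, div_mul_cancel₀ _ hn.ne']
  have hre := mul_le_mul_of_nonneg_left (neg_le.1 (abs_le.1 (Complex.abs_re_le_norm (w 0))).1) ht.le
  linarith [Complex.abs_im_le_norm (w 0)]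

lemma isBoundedUnder_im_div_re (ht : 0 < t) (hw : IsSectorPath t w)
    (hre : Tendsto (fun n => (w n).re) atTop atTop) :
    IsBoundedUnder (· ≤ ·) atTop fun n => |(w n).im / (w n).re| := by
  have hlim : Tendsto (fun n => t + (1 + t) * ‖w 0‖ / (w n).re) atTop (𝓝 (t + 0)) :=
    (hre.const_div_atTop _).const_add t
  exact hlim.isBoundedUnder_le.mono_le
    ((hre.eventually_gt_atTop 0).mono fun n hn => hw.abs_im_div_re_le ht hn)

lemma tendsto_slope_sub (ht : 0 < t) (hw : IsSectorPath t w)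
    (hre : Tendsto (fun n => (w n).re) atTop atTop)
    (hstep : Tendsto (fun n => w (n + 1) - w n) atTop (𝓝 0)) :
    Tendsto (fun n => (w (n + 1)).im / (w (n + 1)).re - (w n).im / (w n).re) atTop (𝓝 0) := by
  have hstep_re := (Complex.continuous_re.tendsto 0).comp hstep
  have hstep_im := (Complex.continuous_im.tendsto 0).comp hstep
  have hnum : Tendsto (fun n => (w (n + 1) - w n).im -
      (w n).im / (w n).re * (w (n + 1) - w n).re) atTop (𝓝 0) := by
    simpa using hstep_im.sub
      (isBoundedUnder_le_mul_tendsto_zero (hw.isBoundedUnder_im_div_re ht hre) hstep_re)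
  refine (hnum.div_atTop ((tendsto_add_atTop_iff_nat 1).2 hre)).congr' ?_
  filter_upwards [hre.eventually_gt_atTop 0] with n hn
  have hn' : 0 < (w (n + 1)).re := hn.trans_le (hw.monotone_re ht n.le_succ)
  rw [Complex.sub_re, Complex.sub_im]
  field_simp
  ring

end IsSectorPath

namespace SlopeCoeffs

/-- The displacement `F(z) - z = ∑_{k ≥ 1} p_k(z)`. -/
noncomputable def displacement (c : SlopeCoeffs) (z : ℂ) : ℂ := ∑' k : ℕ, c.term (k + 1) z

/-- The point `w` keeps a distance of at least `m γ_k` from each branch point `-γ_k`. The series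
`displacement` at `w` is then dominated by `m⁻¹ ∑ a_k / γ_k ^ ε_k`. -/
structure Dominated (c : SlopeCoeffs) (m : ℝ) (w : ℂ) : Prop where
  pos : 0 < m
  le_one : m ≤ 1
  mul_le : ∀ k, 1 ≤ k → m * c.γ k ≤ ‖w + c.γ k‖

/-- A bound for the gap between `displacement` and the edge `arg = (-1) ^ k θ` of the sector, per
unit of real part, at points `w` with `γ_k ≤ Re w` and `‖w + γ_k‖ ≤ C γ_k ^ 2`. -/
noncomputable def directionError (c : SlopeCoeffs) (θ C : ℝ) (k : ℕ) : ℝ :=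
  (1 + Real.tan θ) * (2 * π * c.ε k / Real.cos θ + (1 + Real.tan θ) * (C / k))

variable {c : SlopeCoeffs} {θ m C : ℝ} {k : ℕ} {w : ℂ}

lemma norm_term (ha : 0 ≤ c.a k) (w : ℂ) : ‖c.term k w‖ = c.a k / ‖w + c.γ k‖ ^ c.ε k := by
  simp only [term, norm_div, norm_mul, Complex.norm_exp_I_mul_ofReal, Complex.norm_cpow_real,
    Complex.norm_real, Real.norm_eq_abs, abs_of_nonneg ha, mul_one]

lemma term_eq_norm_mul_exp (ha : 0 ≤ c.a k) (hw : w + c.γ k ≠ 0) :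
    c.term k w = ‖c.term k w‖ *
      Complex.exp ((c.ϑ k - c.ε k * Complex.arg (w + c.γ k) : ℝ) * Complex.I) := by
  rw [norm_term ha, Real.rpow_def_of_pos (norm_pos_iff.2 hw), term, Complex.cpow_def_of_ne_zero hw,
    Complex.log]
  push_cast
  rw [div_eq_mul_inv, div_eq_mul_inv, ← Complex.exp_neg, ← Complex.exp_neg, mul_assoc, mul_assoc,
    ← Complex.exp_add, ← Complex.exp_add]
  ring_nf

lemma Δ_pos (θ : ℝ) : 0 < Δ θ := by
  unfold Δ
  positivity

lemma Δ_le_one (θ : ℝ) : Δ θ ≤ 1 := by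
  rw [Δ, div_le_one (by positivity), Real.one_le_sqrt]
  linarith [sq_nonneg (Real.tan θ)]

lemma dominated_one (hw : 0 ≤ w.re) : c.Dominated 1 w := by
  refine ⟨one_pos, le_rfl, fun k _ => ?_⟩
  have hre := Complex.re_le_norm (w + c.γ k)
  rw [Complex.add_re, Complex.ofReal_re] at hre
  linarith

namespace Admissible

lemma θ_pos (h : c.Admissible θ) : 0 < θ :=
  (mul_pos Real.pi_pos (h.ε_pos 1 le_rfl)).trans_le (h.ε_le 1 le_rfl)

lemma cos_pos (h : c.Admissible θ) (hθ : θ < π / 2) : 0 < Real.cos θ :=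
  Real.cos_pos_of_mem_Ioo ⟨by linarith [h.θ_pos], hθ⟩

lemma tan_pos (h : c.Admissible θ) (hθ : θ < π / 2) : 0 < Real.tan θ :=
  Real.tan_pos_of_pos_of_lt_pi_div_two h.θ_pos hθ

lemma ε_le_one (h : c.Admissible θ) (hθ : θ < π / 2) (hk : 1 ≤ k) : c.ε k ≤ 1 :=
  le_of_mul_le_mul_left (by linarith [h.ε_le k hk, Real.pi_pos]) Real.pi_pos

lemma ϑ_eq (h : c.Admissible θ) (hk : 1 ≤ k) : c.ϑ k = (-1) ^ k * (θ - π * c.ε k) := by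
  obtain ⟨j, rfl | rfl⟩ := Nat.even_or_odd' k
  · rw [(even_two_mul j).neg_one_pow]
    linarith [h.angle_even j (by omega)]
  · have hodd := h.angle_odd (j + 1) (by omega)
    rw [show 2 * (j + 1) - 1 = 2 * j + 1 by omega] at hodd
    rw [(odd_two_mul_add_one j).neg_one_pow]
    linarith

lemma exists_term_eq_norm_mul_exp (h : c.Admissible θ) (hk : 1 ≤ k) (hw : w + c.γ k ≠ 0) :
    ∃ ψ : ℝ, |ψ| ≤ θ ∧ θ - 2 * π * c.ε k ≤ (-1) ^ k * ψ ∧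
      c.term k w = ‖c.term k w‖ * Complex.exp (ψ * Complex.I) := by
  have hsign : |(-1 : ℝ) ^ k| = 1 := abs_neg_one_pow k
  have harg : |c.ε k * Complex.arg (w + c.γ k)| ≤ π * c.ε k := by
    rw [abs_mul, abs_of_pos (h.ε_pos k hk), mul_comm π]
    exact mul_le_mul_of_nonneg_left (Complex.abs_arg_le_pi _) (h.ε_pos k hk).le
  refine ⟨_, ?_, ?_, term_eq_norm_mul_exp (h.a_pos k hk).le hw⟩
  · have hϑ : |c.ϑ k| = θ - π * c.ε k := by
      rw [h.ϑ_eq hk, abs_mul, hsign, one_mul, abs_of_nonneg (sub_nonneg.2 (h.ε_le k hk))]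
    linarith [abs_sub (c.ϑ k) (c.ε k * Complex.arg (w + c.γ k))]
  · have hϑ : (-1) ^ k * c.ϑ k = θ - π * c.ε k := by
      rw [h.ϑ_eq hk, ← mul_assoc, ← mul_pow, neg_one_mul, neg_neg, one_pow, one_mul]
    have hle := le_abs_self ((-1) ^ k * (c.ε k * Complex.arg (w + c.γ k)))
    rw [abs_mul, hsign, one_mul] at hle
    linarith

lemma term_mem_slopeSector (h : c.Admissible θ) (hθ : θ < π / 2) (hk : 1 ≤ k)
    (hw : w + c.γ k ≠ 0) : c.term k w ∈ slopeSector (Real.tan θ) := by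
  obtain ⟨ψ, hψ, -, hterm⟩ := h.exists_term_eq_norm_mul_exp hk hw
  rw [hterm]
  exact mul_exp_mem_slopeSector (norm_nonneg _) hθ hψ

lemma sectorGap_term_le (h : c.Admissible θ) (hθ : θ < π / 2) (hk : 1 ≤ k) (hw : w + c.γ k ≠ 0) :
    sectorGap (Real.tan θ) ((-1) ^ k) (c.term k w) ≤
      ‖c.term k w‖ * (2 * π * c.ε k / Real.cos θ) := by
  obtain ⟨ψ, hψ, hψk, hterm⟩ := h.exists_term_eq_norm_mul_exp hk hw
  have hcos := h.cos_pos hθ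
  have hsign : |(-1) ^ k * ψ| ≤ θ := by rwa [abs_mul, abs_neg_one_pow, one_mul]
  calc sectorGap (Real.tan θ) ((-1) ^ k) (c.term k w)
      = ‖c.term k w‖ * Real.sin (θ - (-1) ^ k * ψ) / Real.cos θ := by
        conv_lhs => rw [hterm]
        exact sectorGap_tan_mul_exp hcos.ne' (abs_neg_one_pow k) _ _
    _ ≤ ‖c.term k w‖ * (2 * π * c.ε k) / Real.cos θ := by
        gcongr
        exact (Real.sin_le (by linarith [abs_le.1 hsign])).trans (by linarith)
    _ = ‖c.term k w‖ * (2 * π * c.ε k / Real.cos θ) := mul_div_assoc _ _ _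

lemma norm_term_le_div (h : c.Admissible θ) (hk : 1 ≤ k) {R : ℝ} (hR : 0 < R)
    (hw : R ≤ ‖w + c.γ k‖) : ‖c.term k w‖ ≤ c.a k / R ^ c.ε k := by
  rw [norm_term (h.a_pos k hk).le]
  have ha := h.a_pos k hk
  gcongr
  exact (h.ε_pos k hk).le

lemma add_ne_zero (h : c.Admissible θ) (hw : c.Dominated m w) (hk : 1 ≤ k) : w + c.γ k ≠ 0 :=
  norm_pos_iff.1 ((mul_pos hw.pos (h.γ_pos k hk)).trans_le (hw.mul_le k hk))

lemma norm_term_le (h : c.Admissible θ) (hθ : θ < π / 2) (hw : c.Dominated m w) (hk : 1 ≤ k) :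
    ‖c.term k w‖ ≤ m⁻¹ * (c.a k / c.γ k ^ c.ε k) := by
  have hm := hw.pos
  have hγ := h.γ_pos k hk
  have ha := h.a_pos k hk
  calc ‖c.term k w‖ ≤ c.a k / (m * c.γ k) ^ c.ε k :=
        h.norm_term_le_div hk (by positivity) (hw.mul_le k hk)
    _ = c.a k / (m ^ c.ε k * c.γ k ^ c.ε k) := by rw [Real.mul_rpow hm.le hγ.le]
    _ ≤ c.a k / (m * c.γ k ^ c.ε k) := by
        gcongr
        simpa using Real.rpow_le_rpow_of_exponent_ge hm hw.le_one (h.ε_le_one hθ hk)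
    _ = m⁻¹ * (c.a k / c.γ k ^ c.ε k) := by field_simp

lemma summable_norm_term (h : c.Admissible θ) (hθ : θ < π / 2) (hw : c.Dominated m w) :
    Summable fun k : ℕ => ‖c.term (k + 1) w‖ :=
  .of_nonneg_of_le (fun _ => norm_nonneg _) (fun k => h.norm_term_le hθ hw k.succ_pos)
    (h.step_summable.mul_left _)

lemma hasSum_displacement (h : c.Admissible θ) (hθ : θ < π / 2) (hw : c.Dominated m w) :
    HasSum (fun k : ℕ => c.term (k + 1) w) (c.displacement w) :=
  (h.summable_norm_term hθ hw).of_norm.hasSum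

lemma norm_displacement_le (h : c.Admissible θ) (hθ : θ < π / 2) (hw : c.Dominated m w) :
    ‖c.displacement w‖ ≤ m⁻¹ * (c.γ 1 / 2) :=
  (tsum_of_norm_bounded (h.step_summable.hasSum.mul_left m⁻¹)
    fun k => h.norm_term_le hθ hw k.succ_pos).trans
    (mul_le_mul_of_nonneg_left h.step (inv_nonneg.2 hw.pos.le))

lemma displacement_mem_slopeSector (h : c.Admissible θ) (hθ : θ < π / 2) (hw : c.Dominated m w) :
    c.displacement w ∈ slopeSector (Real.tan θ) :=
  tsum_mem (isClosed_slopeSector _) fun k =>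
    h.term_mem_slopeSector hθ k.succ_pos (h.add_ne_zero hw k.succ_pos)

lemma norm_term_le_displacement_re (h : c.Admissible θ) (hθ : θ < π / 2) (hw : c.Dominated m w)
    (hk : 1 ≤ k) : ‖c.term k w‖ ≤ (1 + Real.tan θ) * (c.displacement w).re := by
  have htan := h.tan_pos hθ
  have hmem : ∀ l, 1 ≤ l → c.term l w ∈ slopeSector (Real.tan θ) := fun l hl =>
    h.term_mem_slopeSector hθ hl (h.add_ne_zero hw hl)
  have hre : (c.term k w).re ≤ (c.displacement w).re := by
    obtain ⟨j, rfl⟩ := Nat.exists_eq_add_of_le' hk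
    exact le_hasSum (Complex.hasSum_re (h.hasSum_displacement hθ hw)) j fun i _ =>
      re_nonneg_of_mem_slopeSector htan (hmem _ i.succ_pos)
  exact (norm_le_of_mem_slopeSector htan (hmem k hk)).trans (by gcongr)

lemma norm_sum_head_le (h : c.Admissible θ) (hk : 1 ≤ k) (hw : c.γ k ≤ w.re) :
    ‖∑ l ∈ Finset.Ico 1 k, c.term l w‖ ≤ Δ θ * c.a k / (2 * k * c.γ k ^ (2 * c.ε k)) := by
  refine (norm_sum_le_of_le _ fun l hl => ?_).trans (h.head_le k hk)
  have hl := (Finset.mem_Ico.1 hl).1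
  refine h.norm_term_le_div hl (h.γ_pos k hk) (hw.trans ?_)
  have hre := Complex.re_le_norm (w + c.γ l)
  rw [Complex.add_re, Complex.ofReal_re] at hre
  linarith [h.γ_pos l hl]

lemma norm_tsum_tail_le (h : c.Admissible θ) (hk : 1 ≤ k) (hw : 0 ≤ w.re) :
    ‖∑' l, c.term (k + 1 + l) w‖ ≤ Δ θ * c.a k / (2 * k * c.γ k ^ (2 * c.ε k)) := by
  have hsummable : Summable fun l : ℕ =>
      c.a (k + 1 + l) / c.γ (k + 1 + l) ^ c.ε (k + 1 + l) :=
    ((summable_nat_add_iff k).2 h.step_summable).congr fun l => by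
      rw [show l + k + 1 = k + 1 + l by omega]
  refine (tsum_of_norm_bounded hsummable.hasSum fun l => ?_).trans (h.tail_le k hk)
  have hdom := (dominated_one (c := c) hw).mul_le (k + 1 + l) (by omega)
  exact h.norm_term_le_div (by omega) (h.γ_pos _ (by omega)) (by rwa [one_mul] at hdom)

lemma displacement_eq_add (h : c.Admissible θ) (hθ : θ < π / 2) (hw : c.Dominated m w)
    (hk : 1 ≤ k) : c.displacement w =
      ∑ l ∈ Finset.Ico 1 k, c.term l w + c.term k w + ∑' l, c.term (k + 1 + l) w := by
  rw [displacement, ← (h.hasSum_displacement hθ hw).summable.sum_add_tsum_nat_add k]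
  congr 1
  · rw [← Finset.sum_Ico_succ_top hk, Finset.sum_Ico_eq_sum_range]
    simp only [Nat.add_sub_cancel, add_comm 1]
  · exact tsum_congr fun l => by rw [show l + k + 1 = k + 1 + l by omega]

lemma norm_displacement_sub_term_le (h : c.Admissible θ) (hθ : θ < π / 2) (hk : 1 ≤ k)
    (hw : c.γ k ≤ w.re) :
    ‖c.displacement w - c.term k w‖ ≤ c.a k / c.γ k ^ (2 * c.ε k) / k := by
  have hw0 : 0 ≤ w.re := (h.γ_pos k hk).le.trans hw
  have ha := h.a_pos k hk
  have hγ := h.γ_pos k hk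
  calc ‖c.displacement w - c.term k w‖
      = ‖∑ l ∈ Finset.Ico 1 k, c.term l w + ∑' l, c.term (k + 1 + l) w‖ := by
        rw [h.displacement_eq_add hθ (dominated_one hw0) hk]
        ring_nf
    _ ≤ 2 * (Δ θ * c.a k / (2 * k * c.γ k ^ (2 * c.ε k))) := by
        linarith [norm_add_le (∑ l ∈ Finset.Ico 1 k, c.term l w) (∑' l, c.term (k + 1 + l) w),
          h.norm_sum_head_le hk hw, h.norm_tsum_tail_le hk hw0]
    _ = Δ θ * (c.a k / c.γ k ^ (2 * c.ε k) / k) := by field_simp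
    _ ≤ c.a k / c.γ k ^ (2 * c.ε k) / k := mul_le_of_le_one_left (by positivity) (Δ_le_one θ)

lemma div_rpow_le_norm_term (h : c.Admissible θ) (hk : 1 ≤ k) (hw : w + c.γ k ≠ 0) {R : ℝ}
    (hR : ‖w + c.γ k‖ ≤ R) : c.a k / R ^ c.ε k ≤ ‖c.term k w‖ := by
  rw [norm_term (h.a_pos k hk).le]
  have ha := h.a_pos k hk
  have := norm_pos_iff.2 hw
  gcongr
  exact (h.ε_pos k hk).le

lemma div_rpow_le_mul_norm_term (h : c.Admissible θ) (hθ : θ < π / 2) (hk : 1 ≤ k) (hC : 1 ≤ C)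
    (hw : w + c.γ k ≠ 0) (hwC : ‖w + c.γ k‖ ≤ C * c.γ k ^ 2) :
    c.a k / c.γ k ^ (2 * c.ε k) ≤ C * ‖c.term k w‖ := by
  have ha := h.a_pos k hk
  have hγ := h.γ_pos k hk
  have hC0 : 0 < C := one_pos.trans_le hC
  calc c.a k / c.γ k ^ (2 * c.ε k) = C ^ c.ε k * (c.a k / (C * c.γ k ^ 2) ^ c.ε k) := by
        rw [Real.mul_rpow hC0.le (by positivity), Real.rpow_mul hγ.le, Real.rpow_two]
        field_simp
    _ ≤ C * ‖c.term k w‖ := by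
        gcongr
        · simpa using Real.rpow_le_rpow_of_exponent_le hC (h.ε_le_one hθ hk)
        · exact h.div_rpow_le_norm_term hk hw hwC

lemma sectorGap_displacement_le (h : c.Admissible θ) (hθ : θ < π / 2) (hk : 1 ≤ k) (hC : 1 ≤ C)
    (hw : c.γ k ≤ w.re) (hwC : ‖w + c.γ k‖ ≤ C * c.γ k ^ 2) :
    sectorGap (Real.tan θ) ((-1) ^ k) (c.displacement w) ≤
      c.directionError θ C k * (c.displacement w).re := by
  have htan := h.tan_pos hθ
  have hcos := h.cos_pos hθ
  have hε := h.ε_pos k hk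
  have hdom : c.Dominated 1 w := dominated_one ((h.γ_pos k hk).le.trans hw)
  have hne := h.add_ne_zero hdom hk
  calc sectorGap (Real.tan θ) ((-1) ^ k) (c.displacement w)
      = sectorGap (Real.tan θ) ((-1) ^ k) (c.term k w) +
          sectorGap (Real.tan θ) ((-1) ^ k) (c.displacement w - c.term k w) := by
        rw [← map_add, add_sub_cancel]
    _ ≤ ‖c.term k w‖ * (2 * π * c.ε k / Real.cos θ) +
          (1 + Real.tan θ) * (C * ‖c.term k w‖ / k) := by
        refine add_le_add (h.sectorGap_term_le hθ hk hne) ?_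
        refine (le_abs_self _).trans
          ((abs_sectorGap_le htan.le (abs_neg_one_pow k).le _).trans ?_)
        gcongr
        refine (h.norm_displacement_sub_term_le hθ hk hw).trans ?_
        gcongr
        exact h.div_rpow_le_mul_norm_term hθ hk hC hne hwC
    _ = (2 * π * c.ε k / Real.cos θ + (1 + Real.tan θ) * (C / k)) * ‖c.term k w‖ := by ring
    _ ≤ (2 * π * c.ε k / Real.cos θ + (1 + Real.tan θ) * (C / k)) *
          ((1 + Real.tan θ) * (c.displacement w).re) := by
        gcongr
        exact h.norm_term_le_displacement_re hθ hdom hk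
    _ = c.directionError θ C k * (c.displacement w).re := by rw [directionError]; ring

lemma directionError_nonneg (h : c.Admissible θ) (hθ : θ < π / 2) (hC : 0 ≤ C) (hk : 1 ≤ k) :
    0 ≤ c.directionError θ C k := by
  have htan := h.tan_pos hθ
  have hcos := h.cos_pos hθ
  have hε := h.ε_pos k hk
  unfold directionError
  positivity

lemma tendsto_directionError (h : c.Admissible θ) (C : ℝ) :
    Tendsto (c.directionError θ C) atTop (𝓝 0) := by
  have hε := (h.ε_lim.const_mul (2 * π)).div_const (Real.cos θ)
  have hC := (tendsto_const_div_atTop_nhds_zero_nat C).const_mul (1 + Real.tan θ)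
  have hlim := (hε.add hC).const_mul (1 + Real.tan θ)
  rwa [mul_zero, zero_div, mul_zero, add_zero, mul_zero] at hlim

lemma tendsto_displacement (h : c.Admissible θ) (hθ : θ < π / 2) {ι : Type*} {l : Filter ι}
    {u : ι → ℂ} (hdom : ∀ᶠ i in l, c.Dominated m (u i))
    (hu : Tendsto (fun i => ‖u i‖) l atTop) :
    Tendsto (fun i => c.displacement (u i)) l (𝓝 0) := by
  have hterm : ∀ k, Tendsto (fun i => c.term (k + 1) (u i)) l (𝓝 0) := fun k => by
    have hnorm : Tendsto (fun i => ‖u i + c.γ (k + 1)‖) l atTop :=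
      tendsto_atTop_mono (fun i => norm_sub_le_norm_add _ _) (tendsto_atTop_add_const_right _ _ hu)
    refine tendsto_zero_iff_norm_tendsto_zero.2 ?_
    simp only [norm_term (h.a_pos (k + 1) k.succ_pos).le]
    exact ((tendsto_rpow_atTop (h.ε_pos _ k.succ_pos)).comp hnorm).const_div_atTop _
  have hsum := tendsto_tsum_of_dominated_convergence (h.step_summable.mul_left m⁻¹) hterm
    (hdom.mono fun i hi k => h.norm_term_le hθ hi k.succ_pos)
  rwa [tsum_zero] at hsum

end Admissible

end SlopeCoeffs

namespace SlopeCoeffs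

/-- The orbits of `F`, with a common constant `m` of domination. -/
structure IsOrbit (c : SlopeCoeffs) (m : ℝ) (w : ℕ → ℂ) : Prop where
  dominated : ∀ n, c.Dominated m (w n)
  step : ∀ n, w (n + 1) = w n + c.displacement (w n)

namespace Admissible

variable {c : SlopeCoeffs} {θ m : ℝ} {k : ℕ} {w : ℕ → ℂ} {N : ℕ → ℕ}

lemma two_le_γ (h : c.Admissible θ) (hk : 1 ≤ k) : 2 ≤ c.γ k := by
  induction k, hk using Nat.le_induction with
  | base => exact h.γ_one
  | succ k hk ih => nlinarith [h.γ_growth k hk]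

lemma add_one_le_γ_succ (h : c.Admissible θ) (hk : 1 ≤ k) : c.γ k + 1 ≤ c.γ (k + 1) := by
  nlinarith [h.γ_growth k hk, h.two_le_γ hk]

lemma γ_one_le (h : c.Admissible θ) (hk : 1 ≤ k) : c.γ 1 ≤ c.γ k := by
  induction k, hk using Nat.le_induction with
  | base => exact le_rfl
  | succ k hk ih => linarith [h.add_one_le_γ_succ hk]

lemma natCast_le_γ (h : c.Admissible θ) (hk : 1 ≤ k) : (k : ℝ) ≤ c.γ k := by
  induction k, hk using Nat.le_induction with
  | base => exact_mod_cast one_le_two.trans h.γ_one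
  | succ k hk ih =>
    push_cast
    linarith [h.add_one_le_γ_succ hk]

lemma tendsto_γ (h : c.Admissible θ) : Tendsto c.γ atTop atTop :=
  tendsto_atTop_mono' _ ((eventually_ge_atTop 1).mono fun _ hk => h.natCast_le_γ hk)
    tendsto_natCast_atTop_atTop

lemma isSectorPath (h : c.Admissible θ) (hθ : θ < π / 2) (hw : c.IsOrbit m w) :
    IsSectorPath (Real.tan θ) w := fun n => by
  rw [hw.step, add_sub_cancel_left]
  exact h.displacement_mem_slopeSector hθ (hw.dominated n)

lemma monotone_re (h : c.Admissible θ) (hθ : θ < π / 2) (hw : c.IsOrbit m w) :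
    Monotone fun n => (w n).re :=
  (h.isSectorPath hθ hw).monotone_re (h.tan_pos hθ)

lemma tendsto_re (h : c.Admissible θ) (hθ : θ < π / 2) (hw : c.IsOrbit m w) :
    Tendsto (fun n => (w n).re) atTop atTop := by
  refine (tendsto_atTop_of_monotone (h.monotone_re hθ hw)).resolve_right fun ⟨L, hL⟩ => ?_
  have hγ := h.γ_pos 1 le_rfl
  have ha := h.a_pos 1 le_rfl
  obtain ⟨B, hB⟩ : ∃ B, ∀ n, ‖w n‖ ≤ B := ⟨_, fun n =>
    (h.isSectorPath hθ hw).norm_le (h.tan_pos hθ) (le_max_left ‖w 0‖ L)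
      (((h.monotone_re hθ hw).ge_of_tendsto hL n).trans (le_max_right _ _))⟩
  have hdisp : Tendsto (fun n => (c.displacement (w n)).re) atTop (𝓝 0) := by
    have hdiff := ((tendsto_add_atTop_iff_nat 1).2 hL).sub hL
    simpa only [hw.step, Complex.add_re, add_sub_cancel_left, sub_self] using hdiff
  have hlower : ∀ n, c.a 1 / (B + c.γ 1) ^ c.ε 1 ≤
      (1 + Real.tan θ) * (c.displacement (w n)).re := fun n =>
    (h.div_rpow_le_norm_term le_rfl (h.add_ne_zero (hw.dominated n) le_rfl)
      ((norm_add_le _ _).trans (by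
        rw [Complex.norm_real, Real.norm_of_nonneg hγ.le]
        linarith [hB n]))).trans
    (h.norm_term_le_displacement_re hθ (hw.dominated n) le_rfl)
  have hle := ge_of_tendsto' (hdisp.const_mul (1 + Real.tan θ)) hlower
  have hB0 : 0 ≤ B := (norm_nonneg _).trans (hB 0)
  rw [mul_zero] at hle
  exact hle.not_gt (by positivity)

lemma tendsto_norm (h : c.Admissible θ) (hθ : θ < π / 2) (hw : c.IsOrbit m w) :
    Tendsto (fun n => ‖w n‖) atTop atTop :=
  tendsto_atTop_mono (fun n => Complex.re_le_norm (w n)) (h.tendsto_re hθ hw)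

lemma tendsto_displacement_orbit (h : c.Admissible θ) (hθ : θ < π / 2) (hw : c.IsOrbit m w) :
    Tendsto (fun n => c.displacement (w n)) atTop (𝓝 0) :=
  h.tendsto_displacement hθ (.of_forall hw.dominated) (h.tendsto_norm hθ hw)

lemma tendsto_slope_sub (h : c.Admissible θ) (hθ : θ < π / 2) (hw : c.IsOrbit m w) :
    Tendsto (fun n => (w (n + 1)).im / (w (n + 1)).re - (w n).im / (w n).re) atTop (𝓝 0) :=
  (h.isSectorPath hθ hw).tendsto_slope_sub (h.tan_pos hθ) (h.tendsto_re hθ hw) <| by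
    simpa only [hw.step, add_sub_cancel_left] using h.tendsto_displacement_orbit hθ hw

lemma sectorGap_le_or_sub_le (h : c.Admissible θ) (hθ : θ < π / 2) (hw : c.IsOrbit m w)
    (hk : 1 ≤ k) (hw0 : ‖w 0‖ ≤ c.γ k) (hm : m⁻¹ * (c.γ 1 / 2) ≤ c.γ k) {n : ℕ}
    (hn : (w n).re ≤ c.γ k ^ 2) :
    sectorGap (Real.tan θ) ((-1) ^ k) (w (n + 1)) ≤
        (1 + Real.tan θ) * ((4 + 2 * Real.tan θ) * c.γ k) ∨
      sectorGap (Real.tan θ) ((-1) ^ k) (w (n + 1)) - sectorGap (Real.tan θ) ((-1) ^ k) (w n) ≤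
        c.directionError θ (4 + 2 * Real.tan θ) k * ((w (n + 1)).re - (w n).re) := by
  have htan := h.tan_pos hθ
  have hγ := h.two_le_γ hk
  have hpath := h.isSectorPath hθ hw
  rcases le_or_gt (w n).re (c.γ k) with hsmall | hlarge
  · left
    have hnorm : ‖w (n + 1)‖ ≤ (4 + 2 * Real.tan θ) * c.γ k := by
      rw [hw.step]
      linarith [norm_add_le (w n) (c.displacement (w n)), hpath.norm_le htan hw0 hsmall,
        h.norm_displacement_le hθ (hw.dominated n)]
    exact (le_abs_self _).trans ((abs_sectorGap_le htan.le (abs_neg_one_pow k).le _).trans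
      (by gcongr))
  · right
    have hγ2 : c.γ k ≤ c.γ k ^ 2 := by nlinarith
    have hnorm : ‖w n + c.γ k‖ ≤ (4 + 2 * Real.tan θ) * c.γ k ^ 2 := by
      have hγnorm : ‖(c.γ k : ℂ)‖ = c.γ k := by
        rw [Complex.norm_real, Real.norm_of_nonneg (by linarith)]
      linarith [norm_add_le (w n) (c.γ k), hpath.norm_le htan (hw0.trans hγ2) hn]
    rw [hw.step, map_add, add_sub_cancel_left, Complex.add_re, add_sub_cancel_left]
    exact h.sectorGap_displacement_le hθ hk (by linarith) hlarge.le hnorm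

lemma sectorGap_exit_le (h : c.Admissible θ) (hθ : θ < π / 2) (hw : c.IsOrbit m w)
    (hk : 1 ≤ k) (hw0 : ‖w 0‖ ≤ c.γ k) (hm : m⁻¹ * (c.γ 1 / 2) ≤ c.γ k) {n : ℕ}
    (hn : IsLeast {n | c.γ k ^ 2 < (w n).re} n) :
    sectorGap (Real.tan θ) ((-1) ^ k) (w n) ≤
      (1 + Real.tan θ) * ((4 + 2 * Real.tan θ) * c.γ k) +
        c.directionError θ (4 + 2 * Real.tan θ) k * ((w n).re - (w 0).re) := by
  have htan := h.tan_pos hθ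
  refine le_add_mul_sub_of_step (x := fun n => (w n).re)
    (g := fun n => sectorGap (Real.tan θ) ((-1) ^ k) (w n)) (h.monotone_re hθ hw)
    (h.directionError_nonneg hθ (by positivity) hk) ?_ fun j hj =>
      h.sectorGap_le_or_sub_le hθ hw hk hw0 hm (not_lt.1 fun hlt => hj.not_ge (hn.2 hlt))
  refine (le_abs_self _).trans ((abs_sectorGap_le htan.le (abs_neg_one_pow k).le _).trans ?_)
  gcongr
  nlinarith [h.γ_pos k hk]

lemma tendsto_re_exit (h : c.Admissible θ)
    (hN : ∀ k, 1 ≤ k → IsLeast {n | c.γ k ^ 2 < (w n).re} (N k)) :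
    Tendsto (fun k => (w (N k)).re) atTop atTop :=
  tendsto_atTop_mono' _ ((eventually_ge_atTop 1).mono fun k hk => (hN k hk).1.le)
    ((tendsto_pow_atTop two_ne_zero).comp h.tendsto_γ)

lemma tan_sub_le_slope_exit (h : c.Admissible θ) (hθ : θ < π / 2) (hw : c.IsOrbit m w)
    (hk : 1 ≤ k) (hw0 : ‖w 0‖ ≤ c.γ k) (hm : m⁻¹ * (c.γ 1 / 2) ≤ c.γ k) {n : ℕ}
    (hn : IsLeast {n | c.γ k ^ 2 < (w n).re} n) :
    Real.tan θ - ((1 + Real.tan θ) * (4 + 2 * Real.tan θ) / c.γ k +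
      c.directionError θ (4 + 2 * Real.tan θ) k * (1 - (w 0).re / (w n).re)) ≤
        (-1) ^ k * ((w n).im / (w n).re) := by
  have htan := h.tan_pos hθ
  have hγ := h.γ_pos k hk
  have hexit : c.γ k ^ 2 < (w n).re := hn.1
  have hpos : 0 < (w n).re := (by positivity : (0 : ℝ) < c.γ k ^ 2).trans hexit
  have hgap := h.sectorGap_exit_le hθ hw hk hw0 hm hn
  rw [sectorGap_apply] at hgap
  have hstart : (1 + Real.tan θ) * ((4 + 2 * Real.tan θ) * c.γ k) ≤
      (1 + Real.tan θ) * (4 + 2 * Real.tan θ) / c.γ k * (w n).re :=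
    calc (1 + Real.tan θ) * ((4 + 2 * Real.tan θ) * c.γ k)
        = (1 + Real.tan θ) * (4 + 2 * Real.tan θ) / c.γ k * c.γ k ^ 2 := by field_simp
      _ ≤ _ := by gcongr
  rw [sub_le_comm, ← mul_le_mul_iff_left₀ hpos, sub_mul, add_mul, mul_assoc _ (1 - _), sub_mul,
    one_mul, mul_assoc _ (_ / _), div_mul_cancel₀ _ hpos.ne', div_mul_cancel₀ _ hpos.ne']
  linarith

lemma tendsto_slope_exit (h : c.Admissible θ) (hθ : θ < π / 2) (hw : c.IsOrbit m w)
    (hN : ∀ k, 1 ≤ k → IsLeast {n | c.γ k ^ 2 < (w n).re} (N k)) :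
    Tendsto (fun k => (-1) ^ k * ((w (N k)).im / (w (N k)).re)) atTop (𝓝 (Real.tan θ)) := by
  have hre := h.tendsto_re_exit hN
  have hupper : Tendsto (fun k => Real.tan θ + (1 + Real.tan θ) * ‖w 0‖ / (w (N k)).re) atTop
      (𝓝 (Real.tan θ)) := by
    simpa using (hre.const_div_atTop ((1 + Real.tan θ) * ‖w 0‖)).const_add (Real.tan θ)
  have hlower : Tendsto (fun k => Real.tan θ -
      ((1 + Real.tan θ) * (4 + 2 * Real.tan θ) / c.γ k +
        c.directionError θ (4 + 2 * Real.tan θ) k * (1 - (w 0).re / (w (N k)).re))) atTop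
      (𝓝 (Real.tan θ)) := by
    have hγ := h.tendsto_γ.const_div_atTop ((1 + Real.tan θ) * (4 + 2 * Real.tan θ))
    have herr := (h.tendsto_directionError (4 + 2 * Real.tan θ)).mul
      ((hre.const_div_atTop (w 0).re).const_sub 1)
    simpa using (hγ.add herr).const_sub (Real.tan θ)
  refine tendsto_of_tendsto_of_tendsto_of_le_of_le' hlower hupper ?_ ?_
  · filter_upwards [eventually_ge_atTop 1, h.tendsto_γ.eventually_ge_atTop ‖w 0‖,
      h.tendsto_γ.eventually_ge_atTop (m⁻¹ * (c.γ 1 / 2))] with k hk hw0 hm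
    exact h.tan_sub_le_slope_exit hθ hw hk hw0 hm (hN k hk)
  · filter_upwards [hre.eventually_gt_atTop 0] with k hpos
    refine (le_abs_self _).trans ?_
    rw [abs_mul, abs_neg_one_pow, one_mul]
    exact (h.isSectorPath hθ hw).abs_im_div_re_le (h.tan_pos hθ) hpos

lemma re_exit_le (h : c.Admissible θ) (hθ : θ < π / 2) (hw : c.IsOrbit m w)
    (hw0 : 0 ≤ (w 0).re) (hk : (w 0).re ≤ c.γ k ^ 2) {n : ℕ}
    (hn : IsLeast {n | c.γ k ^ 2 < (w n).re} n) : (w n).re ≤ c.γ k ^ 2 + c.γ 1 / 2 := by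
  obtain ⟨j, rfl⟩ : ∃ j, n = j + 1 :=
    Nat.exists_eq_succ_of_ne_zero fun hzero => (hzero ▸ hn.1 : c.γ k ^ 2 < (w 0).re).not_ge hk
  have hj : (w j).re ≤ c.γ k ^ 2 := not_lt.1 fun hlt => j.lt_succ_self.not_ge (hn.2 hlt)
  have hdisp := h.norm_displacement_le hθ
    (dominated_one (hw0.trans (h.monotone_re hθ hw j.zero_le)))
  rw [inv_one, one_mul] at hdisp
  rw [hw.step, Complex.add_re]
  exact add_le_add hj ((Complex.re_le_norm _).trans hdisp)

lemma strictMonoOn_exit (h : c.Admissible θ) (hθ : θ < π / 2) (hw : c.IsOrbit m w)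
    (hw0 : 0 ≤ (w 0).re) (hw0' : (w 0).re ≤ c.γ 1 ^ 2)
    (hN : ∀ k, 1 ≤ k → IsLeast {n | c.γ k ^ 2 < (w n).re} (N k)) :
    StrictMonoOn N (Set.Ici 1) := by
  refine strictMonoOn_of_lt_add_one Set.ordConnected_Ici fun k _ hk _ => ?_
  have hγ1 := h.two_le_γ le_rfl
  have hγ := h.γ_one_le hk
  have hle := h.re_exit_le hθ hw hw0 (hw0'.trans (by gcongr)) (hN k hk)
  have hlt : c.γ (k + 1) ^ 2 < (w (N (k + 1))).re := (hN (k + 1) (by omega)).1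
  have hgap : c.γ k ^ 2 + c.γ 1 / 2 ≤ c.γ (k + 1) ^ 2 := by
    have hsq : 2 * c.γ (k + 1) ≤ c.γ (k + 1) ^ 2 := by
      nlinarith [h.two_le_γ (k := k + 1) (by omega)]
    nlinarith [h.γ_growth k hk]
  exact (h.monotone_re hθ hw).reflect_lt (hle.trans_lt (hgap.trans_lt hlt))

end Admissible

end SlopeCoeffs

lemma arg_mem_Ioo_of_im_pos {z : ℂ} (hz : 0 < z.im) : z.arg ∈ Set.Ioo 0 π :=
  ⟨(Complex.arg_nonneg_iff.2 hz.le).lt_of_ne fun h => hz.ne' (Complex.arg_eq_zero_iff.1 h.symm).2,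
    Complex.arg_lt_pi_iff.2 (Or.inr hz.ne')⟩

lemma arg_eq_arg_add_arctan {ξ z : ℂ} (hξ : 0 < ξ.im) (hz : 0 < z.im)
    (hre : 0 < (starRingEnd ℂ ξ * z).re) :
    z.arg = ξ.arg + Real.arctan ((starRingEnd ℂ ξ * z).im / (starRingEnd ℂ ξ * z).re) := by
  have hξarg := arg_mem_Ioo_of_im_pos hξ
  have hzarg := arg_mem_Ioo_of_im_pos hz
  have hconj : (starRingEnd ℂ ξ).arg = -ξ.arg := by
    rw [Complex.arg_conj, if_neg hξarg.2.ne]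
  have hmul : (starRingEnd ℂ ξ * z).arg = z.arg - ξ.arg := by
    have hne := mul_ne_zero_iff.1 (ne_of_apply_ne Complex.re hre.ne')
    rw [Complex.arg_mul hne.1 hne.2 (by rw [hconj]; constructor <;> linarith [hξarg.1, hξarg.2,
      hzarg.1, hzarg.2]), hconj, neg_add_eq_sub]
  have hright := abs_lt.1 (Complex.abs_arg_lt_pi_div_two_iff.2 (Or.inl hre))
  rw [← Complex.tan_arg, Real.arctan_tan hright.1 hright.2, hmul, add_sub_cancel]

lemma add_ofReal_mem_slitPlane {ξ v : ℂ} (hξ : 0 ≤ ξ.im) (hv : 0 < (ξ * v).im) {r : ℝ}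
    (hr : 0 ≤ r) : v + r ∈ Complex.slitPlane := by
  rw [Complex.mem_slitPlane_iff, Complex.add_re, Complex.add_im, Complex.ofReal_re,
    Complex.ofReal_im, add_zero]
  by_contra! hneg
  rw [Complex.mul_im, hneg.2] at hv
  nlinarith [mul_nonneg hξ hr]

/-- The unit vectors `ξ` for which the sector of half-angle `θ` about the ray through `ξ` lies in
the closed upper half-plane. -/
structure IsSectorAxis (θ : ℝ) (ξ : ℂ) : Prop where
  norm_eq_one : ‖ξ‖ = 1
  arg_mem : ξ.arg ∈ Set.Icc θ (π - θ)

namespace IsSectorAxis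

variable {θ : ℝ} {ξ v : ℂ}

lemma mul_conj_mul (hξ : IsSectorAxis θ ξ) (z : ℂ) : ξ * (starRingEnd ℂ ξ * z) = z := by
  rw [← mul_assoc, Complex.mul_conj, Complex.normSq_eq_norm_sq, hξ.norm_eq_one, one_pow,
    Complex.ofReal_one, one_mul]

lemma conj_mul_mul (hξ : IsSectorAxis θ ξ) (z : ℂ) : starRingEnd ℂ ξ * (ξ * z) = z := by
  rw [mul_left_comm, hξ.mul_conj_mul]

lemma norm_conj_mul (hξ : IsSectorAxis θ ξ) (z : ℂ) : ‖starRingEnd ℂ ξ * z‖ = ‖z‖ := by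
  rw [norm_mul, Complex.norm_conj, hξ.norm_eq_one, one_mul]

lemma im_pos (hξ : IsSectorAxis θ ξ) (h0 : 0 < θ) : 0 < ξ.im := by
  rw [← Complex.norm_mul_sin_arg, hξ.norm_eq_one, one_mul]
  exact Real.sin_pos_of_pos_of_lt_pi (h0.trans_le hξ.arg_mem.1) (by linarith [hξ.arg_mem.2])

lemma abs_re_mul_tan_le_im (hξ : IsSectorAxis θ ξ) (h0 : 0 < θ) (hθ : θ < π / 2) :
    |ξ.re| * Real.tan θ ≤ ξ.im := by
  have hcos : 0 < Real.cos θ := Real.cos_pos_of_mem_Ioo ⟨by linarith, hθ⟩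
  have hsin : 0 ≤ Real.sin θ := Real.sin_nonneg_of_nonneg_of_le_pi h0.le (by linarith)
  have hsub : 0 ≤ Real.sin (ξ.arg - θ) := Real.sin_nonneg_of_nonneg_of_le_pi
    (by linarith [hξ.arg_mem.1]) (by linarith [hξ.arg_mem.2])
  have hadd : 0 ≤ Real.sin (ξ.arg + θ) := Real.sin_nonneg_of_nonneg_of_le_pi
    (by linarith [hξ.arg_mem.1]) (by linarith [hξ.arg_mem.2])
  rw [Real.sin_sub] at hsub
  rw [Real.sin_add] at hadd
  rw [← Complex.norm_mul_sin_arg, ← Complex.norm_mul_cos_arg, hξ.norm_eq_one, one_mul, one_mul,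
    Real.tan_eq_sin_div_cos, ← mul_div_assoc, div_le_iff₀ hcos]
  rw [← abs_of_nonneg hsin, ← abs_mul, abs_le]
  constructor <;> linarith

lemma im_mul_nonneg (hξ : IsSectorAxis θ ξ) (h0 : 0 < θ) (hθ : θ < π / 2)
    (hv : v ∈ slopeSector (Real.tan θ)) : 0 ≤ (ξ * v).im := by
  have hre := re_nonneg_of_mem_slopeSector (Real.tan_pos_of_pos_of_lt_pi_div_two h0 hθ) hv
  have hcross : |ξ.re * v.im| ≤ ξ.im * v.re :=
    calc |ξ.re * v.im| = |ξ.re| * |v.im| := abs_mul _ _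
      _ ≤ |ξ.re| * (Real.tan θ * v.re) :=
        mul_le_mul_of_nonneg_left (mem_slopeSector.1 hv) (abs_nonneg _)
      _ = |ξ.re| * Real.tan θ * v.re := (mul_assoc _ _ _).symm
      _ ≤ ξ.im * v.re := mul_le_mul_of_nonneg_right (hξ.abs_re_mul_tan_le_im h0 hθ) hre
  rw [Complex.mul_im]
  linarith [abs_le.1 hcross]

lemma dominated (hξ : IsSectorAxis θ ξ) (h0 : 0 < θ) (c : SlopeCoeffs) (hv : 0 < (ξ * v).im) :
    c.Dominated ξ.im v := by
  refine ⟨hξ.im_pos h0, hξ.norm_eq_one ▸ Complex.im_le_norm ξ, fun k _ => ?_⟩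
  calc ξ.im * c.γ k ≤ (ξ * v).im + ξ.im * c.γ k := le_add_of_nonneg_left hv.le
    _ = (ξ * (v + c.γ k)).im := by rw [mul_add, Complex.add_im, Complex.im_mul_ofReal]
    _ ≤ ‖ξ * (v + c.γ k)‖ := Complex.im_le_norm _
    _ = ‖v + c.γ k‖ := by rw [norm_mul, hξ.norm_eq_one, one_mul]

lemma dominated_conj_mul (hξ : IsSectorAxis θ ξ) (h0 : 0 < θ) (c : SlopeCoeffs) (z : ℍ) :
    c.Dominated ξ.im (starRingEnd ℂ ξ * z) :=
  hξ.dominated h0 c (by rw [hξ.mul_conj_mul]; exact z.im_pos)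

end IsSectorAxis

namespace SlopeCoeffs

/-- The map `z ↦ ξ F(conj ξ · z)` on the upper half-plane. Outside of the range of `ℍ` the function
`ofComplex` takes a junk value, but `coe_rotatedMap` shows that this does not occur when `ξ` is
a sector axis. -/
noncomputable def rotatedMap (c : SlopeCoeffs) (ξ : ℂ) (z : ℍ) : ℍ :=
  ofComplex (ξ * c.F (starRingEnd ℂ ξ * z))

/-- The orbit of `z` under `rotatedMap`, rotated back by `conj ξ`; it is an orbit of `F`. -/
noncomputable def rotatedOrbit (c : SlopeCoeffs) (ξ : ℂ) (z : ℍ) (n : ℕ) : ℂ :=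
  starRingEnd ℂ ξ * ((c.rotatedMap ξ)^[n] z : ℍ)

variable {c : SlopeCoeffs} {θ : ℝ} {ξ : ℂ}

lemma mul_F_conj_mul (hξ : IsSectorAxis θ ξ) (z : ℂ) :
    ξ * c.F (starRingEnd ℂ ξ * z) = z + ξ * c.displacement (starRingEnd ℂ ξ * z) := by
  rw [F, mul_add, hξ.mul_conj_mul, displacement]

lemma differentiableAt_term {k : ℕ} {v : ℂ} (hv : v + c.γ k ∈ Complex.slitPlane) :
    DifferentiableAt ℂ (c.term k) v := by
  have hpow : DifferentiableAt ℂ (fun v : ℂ => (v + c.γ k) ^ (c.ε k : ℂ)) v :=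
    (differentiableAt_id.add_const _).cpow (differentiableAt_const _) hv
  refine (differentiableAt_const _).div hpow fun hzero => ?_
  exact Complex.slitPlane_ne_zero hv ((Complex.cpow_eq_zero_iff _ _).1 hzero).1

namespace Admissible

lemma im_le_im_mul_F (h : c.Admissible θ) (hθ : θ < π / 2) (hξ : IsSectorAxis θ ξ) (z : ℍ) :
    z.im ≤ (ξ * c.F (starRingEnd ℂ ξ * z)).im := by
  rw [mul_F_conj_mul hξ, Complex.add_im]
  exact le_add_of_nonneg_right (hξ.im_mul_nonneg h.θ_pos hθ
    (h.displacement_mem_slopeSector hθ (hξ.dominated_conj_mul h.θ_pos c z)))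

lemma coe_rotatedMap (h : c.Admissible θ) (hθ : θ < π / 2) (hξ : IsSectorAxis θ ξ) (z : ℍ) :
    (c.rotatedMap ξ z : ℂ) = ξ * c.F (starRingEnd ℂ ξ * z) := by
  rw [rotatedMap, ofComplex_apply_of_im_pos (z.im_pos.trans_le (h.im_le_im_mul_F hθ hξ z))]

lemma coe_rotatedMap_eq_add (h : c.Admissible θ) (hθ : θ < π / 2) (hξ : IsSectorAxis θ ξ) (z : ℍ) :
    (c.rotatedMap ξ z : ℂ) = z + ξ * c.displacement (starRingEnd ℂ ξ * z) := by
  rw [h.coe_rotatedMap hθ hξ, mul_F_conj_mul hξ]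

lemma im_le_im_iterate_rotatedMap (h : c.Admissible θ) (hθ : θ < π / 2) (hξ : IsSectorAxis θ ξ)
    (z : ℍ) (n : ℕ) : z.im ≤ ((c.rotatedMap ξ)^[n] z).im := by
  induction n with
  | zero => exact le_rfl
  | succ n ih =>
    rw [Function.iterate_succ_apply', ← coe_im (c.rotatedMap ξ _), h.coe_rotatedMap hθ hξ]
    exact ih.trans (h.im_le_im_mul_F hθ hξ _)

lemma isOrbit_rotatedOrbit (h : c.Admissible θ) (hθ : θ < π / 2) (hξ : IsSectorAxis θ ξ) (z : ℍ) :
    c.IsOrbit ξ.im (c.rotatedOrbit ξ z) where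
  dominated _ := hξ.dominated_conj_mul h.θ_pos c _
  step n := by
    rw [rotatedOrbit, Function.iterate_succ_apply', h.coe_rotatedMap_eq_add hθ hξ, mul_add,
      hξ.conj_mul_mul, rotatedOrbit]

lemma differentiableOn_displacement (h : c.Admissible θ) (hθ : θ < π / 2)
    (hξ : IsSectorAxis θ ξ) : DifferentiableOn ℂ c.displacement {v | 0 < (ξ * v).im} := by
  have hopen : IsOpen {v : ℂ | 0 < (ξ * v).im} := isOpen_lt (by fun_prop) (by fun_prop)
  refine Complex.differentiableOn_tsum_of_summable_norm (h.step_summable.mul_left ξ.im⁻¹)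
    (fun k v hv => ?_) hopen fun k v hv => ?_
  · exact (differentiableAt_term (add_ofReal_mem_slitPlane (hξ.im_pos h.θ_pos).le hv
      (h.γ_pos _ k.succ_pos).le)).differentiableWithinAt
  · exact h.norm_term_le hθ (hξ.dominated h.θ_pos c hv) k.succ_pos

lemma mdifferentiable_rotatedMap (h : c.Admissible θ) (hθ : θ < π / 2) (hξ : IsSectorAxis θ ξ) :
    MDifferentiable 𝓘(ℂ) 𝓘(ℂ) (c.rotatedMap ξ) := by
  have hdisp : DifferentiableOn ℂ (fun z : ℂ => z + ξ * c.displacement (starRingEnd ℂ ξ * z))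
      {z | 0 < z.im} :=
    differentiableOn_id.add (((h.differentiableOn_displacement hθ hξ).comp
      (differentiableOn_id.const_mul _) fun z hz => by
        simpa only [Set.mem_ofPred_eq, id_eq, hξ.mul_conj_mul] using hz).const_mul ξ)
  have hcoe : MDifferentiable 𝓘(ℂ) 𝓘(ℂ) fun z : ℍ => ξ * c.F (starRingEnd ℂ ξ * z) := by
    refine mdifferentiable_iff.2 (hdisp.congr fun z hz => ?_)
    rw [Function.comp_apply, ofComplex_apply_of_im_pos hz, mul_F_conj_mul hξ]
  exact fun z => (mdifferentiableAt_ofComplex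
    (z.im_pos.trans_le (h.im_le_im_mul_F hθ hξ z))).comp z (hcoe z)

lemma hasAngularLimitInfty (h : c.Admissible θ) (hθ : θ < π / 2) (hξ : IsSectorAxis θ ξ) :
    HasAngularLimitInfty (fun z => (c.rotatedMap ξ z : ℂ) / z) 1 := fun δ _ => by
  refine (tendsto_iff_norm_sub_tendsto_zero.2 ?_).mono_left inf_le_left
  have hlim : Tendsto (fun z : ℍ => ξ.im⁻¹ * (c.γ 1 / 2) / ‖(z : ℂ)‖)
      (comap (fun z : ℍ => ‖(z : ℂ)‖) atTop) (𝓝 0) :=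
    tendsto_comap.const_div_atTop _
  refine squeeze_zero (fun _ => norm_nonneg _) (fun z => ?_) hlim
  rw [h.coe_rotatedMap_eq_add hθ hξ, add_div, div_self z.ne_zero, add_sub_cancel_left, norm_div,
    norm_mul, hξ.norm_eq_one, one_mul]
  gcongr
  exact h.norm_displacement_le hθ (hξ.dominated_conj_mul h.θ_pos c z)

lemma hasDenjoyWolffInfty (h : c.Admissible θ) (hθ : θ < π / 2) (hξ : IsSectorAxis θ ξ) :
    HasDenjoyWolffInfty (c.rotatedMap ξ) := fun K hK R => by
  have hcont : ∀ n, Continuous fun z => (c.rotatedOrbit ξ z n).re := fun n =>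
    Complex.continuous_re.comp (continuous_const.mul (continuous_coe.comp
      ((h.mdifferentiable_rotatedMap hθ hξ).continuous.iterate n)))
  have hmono : ∀ z, Monotone fun n => (c.rotatedOrbit ξ z n).re := fun z =>
    h.monotone_re hθ (h.isOrbit_rotatedOrbit hθ hξ z)
  have hcover : K ⊆ ⋃ n, {z | R < (c.rotatedOrbit ξ z n).re} := fun z _ =>
    Set.mem_iUnion.2
      ((h.tendsto_re hθ (h.isOrbit_rotatedOrbit hθ hξ z)).eventually_gt_atTop R).exists
  have hdir : Directed (· ⊆ ·) fun n => {z | R < (c.rotatedOrbit ξ z n).re} :=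
    Monotone.directed_le fun m n hmn z (hz : R < _) => hz.trans_le (hmono z hmn)
  obtain ⟨N, hN⟩ := hK.elim_directed_cover _ (fun n => isOpen_lt continuous_const (hcont n))
    hcover hdir
  filter_upwards [eventually_ge_atTop N] with n hn z hz
  calc R < (c.rotatedOrbit ξ z N).re := hN hz
    _ ≤ (c.rotatedOrbit ξ z n).re := hmono z hn
    _ ≤ ‖c.rotatedOrbit ξ z n‖ := Complex.re_le_norm _
    _ = ‖((c.rotatedMap ξ)^[n] z : ℂ)‖ := hξ.norm_conj_mul _

lemma isParabolicInfty (h : c.Admissible θ) (hθ : θ < π / 2) (hξ : IsSectorAxis θ ξ) :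
    IsParabolicInfty (c.rotatedMap ξ) :=
  ⟨h.mdifferentiable_rotatedMap hθ hξ, h.hasDenjoyWolffInfty hθ hξ, h.hasAngularLimitInfty hθ hξ⟩

lemma hasZeroHyperbolicStep (h : c.Admissible θ) (hθ : θ < π / 2) (hξ : IsSectorAxis θ ξ) :
    HasZeroHyperbolicStep (c.rotatedMap ξ) := fun z => by
  have hlim := (h.tendsto_displacement_orbit hθ (h.isOrbit_rotatedOrbit hθ hξ z)).norm.div_const
    z.im
  rw [norm_zero, zero_div] at hlim
  refine squeeze_zero (fun _ => dist_nonneg) (fun n => ?_) hlim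
  have him : z.im ≤ √(((c.rotatedMap ξ)^[n + 1] z).im * ((c.rotatedMap ξ)^[n] z).im) :=
    Real.le_sqrt_of_sq_le (by
      rw [sq]
      exact mul_le_mul (h.im_le_im_iterate_rotatedMap hθ hξ z _)
        (h.im_le_im_iterate_rotatedMap hθ hξ z _) z.im_pos.le (im_pos _).le)
  refine (dist_le_dist_coe_div_sqrt _ _).trans
    (div_le_div₀ (norm_nonneg _) (le_of_eq ?_) z.im_pos him)
  rw [Function.iterate_succ_apply', Complex.dist_eq, h.coe_rotatedMap_eq_add hθ hξ,
    add_sub_cancel_left, norm_mul, hξ.norm_eq_one, one_mul, rotatedOrbit]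

end Admissible

end SlopeCoeffs

lemma tendsto_even_of_tendsto_neg_one_pow_mul_sub {x : ℕ → ℝ} {L t : ℝ}
    (hx : Tendsto (fun k => (-1) ^ k * (x k - L)) atTop (𝓝 t)) :
    Tendsto (fun k => x (2 * k)) atTop (𝓝 (L + t)) := by
  have hmul : Tendsto (fun k : ℕ => 2 * k) atTop atTop :=
    tendsto_atTop_mono (fun k => Nat.le_mul_of_pos_left k two_pos) tendsto_id
  refine ((hx.comp hmul).const_add L).congr fun k => ?_
  rw [Function.comp_apply, (even_two_mul k).neg_one_pow, one_mul, add_sub_cancel]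

lemma tendsto_odd_of_tendsto_neg_one_pow_mul_sub {x : ℕ → ℝ} {L t : ℝ}
    (hx : Tendsto (fun k => (-1) ^ k * (x k - L)) atTop (𝓝 t)) :
    Tendsto (fun k => x (2 * k + 1)) atTop (𝓝 (L - t)) := by
  have hmul : Tendsto (fun k : ℕ => 2 * k + 1) atTop atTop :=
    tendsto_atTop_mono (fun k => by rw [id_eq]; omega) tendsto_id
  refine ((hx.comp hmul).const_sub L).congr fun k => ?_
  rw [Function.comp_apply, (odd_two_mul_add_one k).neg_one_pow, neg_one_mul, sub_neg_eq_add,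
    add_sub_cancel]

lemma abs_arctan_sub_arctan_le (x y : ℝ) : |Real.arctan x - Real.arctan y| ≤ |x - y| := by
  have hlip : LipschitzWith 1 Real.arctan :=
    lipschitzWith_of_nnnorm_deriv_le Real.differentiable_arctan fun x => by
      rw [← NNReal.coe_le_coe, coe_nnnorm, Real.deriv_arctan, Real.norm_of_nonneg (by positivity),
        NNReal.coe_one, div_le_one (by positivity)]
      linarith [sq_nonneg x]
  simpa only [NNReal.coe_one, one_mul, Real.dist_eq] using hlip.dist_le_mul x y

lemma slopeSet_eq_setOf_mapClusterPt (f : ℍ → ℍ) (z : ℍ) :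
    slopeSet f z = {s | MapClusterPt s atTop fun n => (f^[n] z : ℂ).arg} := by
  ext s
  refine ⟨fun ⟨_, φ, hφ, hlim⟩ => hlim.mapClusterPt.of_comp hφ.tendsto_atTop, fun hs => ⟨?_, ?_⟩⟩
  · exact isClosed_Icc.mem_of_mapClusterPt hs (.of_forall fun n =>
      Set.Ioo_subset_Icc_self (arg_mem_Ioo_of_im_pos (f^[n] z).im_pos))
  · exact hs.tendsto_subseq

namespace SlopeCoeffs.Admissible

variable {c : SlopeCoeffs} {θ : ℝ} {ξ : ℂ}

lemma arg_iterate_rotatedMap (h : c.Admissible θ) (hξ : IsSectorAxis θ ξ) {z : ℍ} {n : ℕ}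
    (hn : 0 < (c.rotatedOrbit ξ z n).re) :
    ((c.rotatedMap ξ)^[n] z : ℂ).arg =
      ξ.arg + Real.arctan ((c.rotatedOrbit ξ z n).im / (c.rotatedOrbit ξ z n).re) :=
  arg_eq_arg_add_arctan (hξ.im_pos h.θ_pos) ((c.rotatedMap ξ)^[n] z).im_pos hn

lemma arctan_tan (h : c.Admissible θ) (hθ : θ < π / 2) : Real.arctan (Real.tan θ) = θ :=
  Real.arctan_tan (by linarith [h.θ_pos]) hθ

lemma isLeast_exitTime (h : c.Admissible θ) (hθ : θ < π / 2) (hξ : IsSectorAxis θ ξ) (z : ℍ)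
    (k : ℕ) : IsLeast {n | c.γ k ^ 2 < (c.rotatedOrbit ξ z n).re}
      (exitTime c ξ (c.rotatedMap ξ) z k) :=
  isLeast_csInf
    ((h.tendsto_re hθ (h.isOrbit_rotatedOrbit hθ hξ z)).eventually_gt_atTop (c.γ k ^ 2)).exists

lemma tendsto_slope_exitTime (h : c.Admissible θ) (hθ : θ < π / 2) (hξ : IsSectorAxis θ ξ) (z : ℍ) :
    Tendsto (fun k => (-1) ^ k *
      ((c.rotatedOrbit ξ z (exitTime c ξ (c.rotatedMap ξ) z k)).im /
        (c.rotatedOrbit ξ z (exitTime c ξ (c.rotatedMap ξ) z k)).re)) atTop (𝓝 (Real.tan θ)) :=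
  h.tendsto_slope_exit hθ (h.isOrbit_rotatedOrbit hθ hξ z) fun k _ => h.isLeast_exitTime hθ hξ z k

lemma tendsto_arg_exitTime (h : c.Admissible θ) (hθ : θ < π / 2) (hξ : IsSectorAxis θ ξ) (z : ℍ) :
    Tendsto (fun k => (-1) ^ k *
      (((c.rotatedMap ξ)^[exitTime c ξ (c.rotatedMap ξ) z k] z : ℂ).arg - ξ.arg)) atTop
      (𝓝 θ) := by
  have harctan := (Real.continuous_arctan.tendsto _).comp (h.tendsto_slope_exitTime hθ hξ z)
  rw [h.arctan_tan hθ] at harctan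
  refine harctan.congr' ?_
  filter_upwards [(h.tendsto_re_exit fun k _ => h.isLeast_exitTime hθ hξ z k).eventually_gt_atTop 0]
    with k hk
  rw [h.arg_iterate_rotatedMap hξ hk, add_sub_cancel_left, Function.comp_apply]
  rcases neg_one_pow_eq_or ℝ k with hsign | hsign
  · rw [hsign, one_mul, one_mul]
  · rw [hsign, neg_one_mul, neg_one_mul, Real.arctan_neg]

lemma tendsto_exitTime (h : c.Admissible θ) (hθ : θ < π / 2) (hξ : IsSectorAxis θ ξ) (z : ℍ) :
    Tendsto (exitTime c ξ (c.rotatedMap ξ) z) atTop atTop :=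
  tendsto_atTop_of_monotone_of_comp (h.monotone_re hθ (h.isOrbit_rotatedOrbit hθ hξ z))
    (h.tendsto_re_exit fun k _ => h.isLeast_exitTime hθ hξ z k)

lemma tendsto_arg_sub (h : c.Admissible θ) (hθ : θ < π / 2) (hξ : IsSectorAxis θ ξ) (z : ℍ) :
    Tendsto (fun n => ((c.rotatedMap ξ)^[n + 1] z : ℂ).arg - ((c.rotatedMap ξ)^[n] z : ℂ).arg)
      atTop (𝓝 0) := by
  have horbit := h.isOrbit_rotatedOrbit hθ hξ z
  refine squeeze_zero_norm' ?_ (tendsto_zero_iff_abs_tendsto_zero _ |>.1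
    (h.tendsto_slope_sub hθ horbit))
  filter_upwards [(h.tendsto_re hθ horbit).eventually_gt_atTop 0] with n hn
  have hn' := hn.trans_le (h.monotone_re hθ horbit n.le_succ)
  rw [h.arg_iterate_rotatedMap hξ hn, h.arg_iterate_rotatedMap hξ hn', add_sub_add_left_eq_sub]
  exact abs_arctan_sub_arctan_le _ _

lemma abs_arg_sub_le_of_mapClusterPt (h : c.Admissible θ) (hθ : θ < π / 2) (hξ : IsSectorAxis θ ξ)
    {z : ℍ} {s : ℝ} (hs : MapClusterPt s atTop fun n => ((c.rotatedMap ξ)^[n] z : ℂ).arg) :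
    |s - ξ.arg| ≤ θ := by
  have horbit := h.isOrbit_rotatedOrbit hθ hξ z
  have hre := h.tendsto_re hθ horbit
  obtain ⟨φ, hφ, hlim⟩ := hs.tendsto_subseq
  have hbound : Tendsto (fun n => Real.arctan (Real.tan θ +
      (1 + Real.tan θ) * ‖c.rotatedOrbit ξ z 0‖ / (c.rotatedOrbit ξ z n).re)) atTop (𝓝 θ) := by
    have hslope := (hre.const_div_atTop
      ((1 + Real.tan θ) * ‖c.rotatedOrbit ξ z 0‖)).const_add (Real.tan θ)
    rw [add_zero] at hslope
    have harctan := (Real.continuous_arctan.tendsto _).comp hslope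
    rwa [h.arctan_tan hθ] at harctan
  refine le_of_tendsto_of_tendsto (hlim.sub_const ξ.arg).abs (hbound.comp hφ.tendsto_atTop) ?_
  filter_upwards [hφ.tendsto_atTop.eventually (hre.eventually_gt_atTop 0)] with k hn
  rw [Function.comp_apply, h.arg_iterate_rotatedMap hξ hn, add_sub_cancel_left]
  have hle := abs_le.1 ((h.isSectorPath hθ horbit).abs_im_div_re_le (h.tan_pos hθ) hn)
  exact abs_le.2 ⟨(Real.arctan_neg _).symm.trans_le (Real.arctan_mono hle.1),
    Real.arctan_mono hle.2⟩

lemma slopeSet_rotatedMap (h : c.Admissible θ) (hθ : θ < π / 2) (hξ : IsSectorAxis θ ξ) (z : ℍ) :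
    slopeSet (c.rotatedMap ξ) z = Set.Icc (ξ.arg - θ) (ξ.arg + θ) := by
  have hexit := h.tendsto_arg_exitTime hθ hξ z
  have htimes := h.tendsto_exitTime hθ hξ z
  rw [slopeSet_eq_setOf_mapClusterPt]
  refine Set.Subset.antisymm (fun s hs => ?_)
    ((ordConnected_setOf_mapClusterPt (h.tendsto_arg_sub hθ hξ z)).out ?_ ?_)
  · have habs := abs_le.1 (h.abs_arg_sub_le_of_mapClusterPt hθ hξ hs)
    constructor <;> linarith
  · exact (tendsto_odd_of_tendsto_neg_one_pow_mul_sub hexit).mapClusterPt.of_comp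
      (htimes.comp (tendsto_atTop_mono (fun k => by rw [id_eq]; omega) tendsto_id))
  · exact (tendsto_even_of_tendsto_neg_one_pow_mul_sub hexit).mapClusterPt.of_comp
      (htimes.comp (tendsto_atTop_mono (fun k => by rw [id_eq]; omega) tendsto_id))

lemma strictMonoOn_exitTime (h : c.Admissible θ) (hθ : θ < π / 2) (hξ : IsSectorAxis θ ξ) {z : ℍ}
    (hz : 0 ≤ (starRingEnd ℂ ξ * z).re) (hz' : (starRingEnd ℂ ξ * z).re ≤ c.γ 1 ^ 2) :
    StrictMonoOn (exitTime c ξ (c.rotatedMap ξ) z) (Set.Ici 1) :=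
  h.strictMonoOn_exit hθ (h.isOrbit_rotatedOrbit hθ hξ z) hz hz'
    fun k _ => h.isLeast_exitTime hθ hξ z k

end SlopeCoeffs.Admissible

namespace SlopeCoeffs

/-- Coefficients with doubly exponential `γ_k`, serving as an example of admissible ones. -/
noncomputable def explicit (θ : ℝ) : SlopeCoeffs where
  a _ := 1
  γ k := Real.exp (4 / Δ θ * π / θ * 64 ^ k)
  ε k := θ / π / 8 ^ k
  ϑ k := (-1) ^ k * (θ - θ / 8 ^ k)

/-- The value of `a_k / γ_k ^ ε_k` for the coefficients `explicit θ`. -/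
noncomputable def explicitSize (θ : ℝ) (k : ℕ) : ℝ := Real.exp (-(4 / Δ θ * 8 ^ k))

variable {θ : ℝ} {k l : ℕ}

lemma explicit_rpow (h0 : 0 < θ) (k l : ℕ) :
    (explicit θ).γ k ^ (explicit θ).ε l = Real.exp (4 / Δ θ * (64 ^ k / 8 ^ l)) := by
  rw [explicit, ← Real.exp_mul]
  congr 1
  field_simp

lemma explicit_div_rpow (h0 : 0 < θ) (k : ℕ) :
    (explicit θ).a k / (explicit θ).γ k ^ (explicit θ).ε k = explicitSize θ k := by
  rw [explicit_rpow h0, ← div_pow, explicitSize, Real.exp_neg, ← one_div]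
  norm_num [explicit]

lemma explicitSize_pos (θ : ℝ) (k : ℕ) : 0 < explicitSize θ k := Real.exp_pos _

lemma explicitSize_mul_pow_le (θ : ℝ) (k : ℕ) : explicitSize θ k * (4 * 8 ^ k) ≤ Δ θ := by
  have hΔ := Δ_pos θ
  rw [explicitSize, Real.exp_neg, inv_mul_le_iff₀ (Real.exp_pos _)]
  calc (4 * 8 ^ k : ℝ) = 4 / Δ θ * 8 ^ k * Δ θ := by field_simp
    _ ≤ Real.exp (4 / Δ θ * 8 ^ k) * Δ θ := by
      gcongr
      linarith [Real.add_one_le_exp (4 / Δ θ * 8 ^ k)]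

lemma explicitSize_le_quarter (θ : ℝ) (k : ℕ) : explicitSize θ k ≤ 1 / 4 := by
  have hpow : (1 : ℝ) ≤ 8 ^ k := one_le_pow₀ (by norm_num)
  nlinarith [explicitSize_pos θ k, explicitSize_mul_pow_le θ k, Δ_le_one θ]

lemma explicitSize_mul_natCast_le (θ : ℝ) (k : ℕ) : explicitSize θ k * (4 * k) ≤ Δ θ := by
  refine le_trans ?_ (explicitSize_mul_pow_le θ k)
  have hpos := (explicitSize_pos θ k).le
  gcongr
  exact_mod_cast (Nat.lt_pow_self (by norm_num : 1 < 8)).le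

lemma exp_neg_mul_le_explicitSize_pow {n : ℕ} {x : ℝ} (hx : n * 8 ^ k ≤ x) :
    Real.exp (-(4 / Δ θ * x)) ≤ explicitSize θ k ^ n := by
  rw [explicitSize, ← Real.exp_nat_mul, Real.exp_le_exp]
  have hmul := mul_le_mul_of_nonneg_left hx (div_pos four_pos (Δ_pos θ)).le
  linarith

lemma explicitSize_add_le (θ : ℝ) (k l : ℕ) :
    explicitSize θ (k + 1 + l) ≤ explicitSize θ k ^ 3 * explicitSize θ k ^ l := by
  rw [← pow_add]
  refine exp_neg_mul_le_explicitSize_pow ?_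
  have hpow : 3 + l ≤ 8 ^ (l + 1) := by
    have hl : l < 8 ^ l := Nat.lt_pow_self (by norm_num)
    omega
  rw [add_assoc, add_comm k, add_comm 1, pow_add]
  gcongr
  exact_mod_cast hpow

lemma hasSum_explicitSize_majorant (θ : ℝ) (k : ℕ) :
    HasSum (fun l => explicitSize θ k ^ 3 * explicitSize θ k ^ l)
      (explicitSize θ k ^ 3 * (1 - explicitSize θ k)⁻¹) :=
  (hasSum_geometric_of_lt_one (explicitSize_pos θ k).le
    ((explicitSize_le_quarter θ k).trans_lt (by norm_num))).mul_left _

lemma summable_explicitSize (θ : ℝ) (k : ℕ) : Summable fun l => explicitSize θ (k + 1 + l) :=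
  .of_nonneg_of_le (fun _ => (explicitSize_pos θ _).le) (explicitSize_add_le θ k)
    (hasSum_explicitSize_majorant θ k).summable

lemma tsum_explicitSize_le (θ : ℝ) (k : ℕ) :
    ∑' l, explicitSize θ (k + 1 + l) ≤ 2 * explicitSize θ k ^ 3 := by
  have hle := explicitSize_le_quarter θ k
  have hpos := explicitSize_pos θ k
  calc ∑' l, explicitSize θ (k + 1 + l)
      ≤ explicitSize θ k ^ 3 * (1 - explicitSize θ k)⁻¹ :=
        hasSum_le (explicitSize_add_le θ k) (summable_explicitSize θ k).hasSum
          (hasSum_explicitSize_majorant θ k)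
    _ ≤ explicitSize θ k ^ 3 * 2 := by
        gcongr
        exact inv_le_of_inv_le₀ two_pos (by linarith)
    _ = 2 * explicitSize θ k ^ 3 := mul_comm _ _

lemma explicit_div_rpow_le_pow (h0 : 0 < θ) (hl : l < k) :
    (explicit θ).a l / (explicit θ).γ k ^ (explicit θ).ε l ≤ explicitSize θ k ^ 8 := by
  rw [explicit_rpow h0, explicit, one_div, ← Real.exp_neg]
  refine exp_neg_mul_le_explicitSize_pow ((le_div_iff₀ (by positivity)).2 ?_)
  calc ((8 : ℕ) : ℝ) * 8 ^ k * 8 ^ l = 8 ^ k * 8 ^ (l + 1) := by push_cast; ring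
    _ ≤ 8 ^ k * 8 ^ k := by
      gcongr
      · norm_num
      · exact hl
    _ = 64 ^ k := by rw [← mul_pow]; norm_num

lemma sum_explicit_le (h0 : 0 < θ) (k : ℕ) :
    ∑ l ∈ Finset.Ico 1 k, (explicit θ).a l / (explicit θ).γ k ^ (explicit θ).ε l ≤
      2 * explicitSize θ k ^ 3 := by
  have hpos := explicitSize_pos θ k
  have hle := explicitSize_le_quarter θ k
  calc ∑ l ∈ Finset.Ico 1 k, (explicit θ).a l / (explicit θ).γ k ^ (explicit θ).ε l
      ≤ (Finset.Ico 1 k).card • explicitSize θ k ^ 8 :=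
        Finset.sum_le_card_nsmul _ _ _ fun l hl =>
          explicit_div_rpow_le_pow h0 (Finset.mem_Ico.1 hl).2
    _ ≤ k * explicitSize θ k ^ 8 := by
        rw [Nat.card_Ico, nsmul_eq_mul]
        gcongr
        exact k.sub_le 1
    _ = explicitSize θ k * k * explicitSize θ k ^ 4 * explicitSize θ k ^ 3 := by ring
    _ ≤ 2 * 1 * explicitSize θ k ^ 3 := by
        gcongr
        · linarith [explicitSize_mul_natCast_le θ k, Δ_le_one θ]
        · exact pow_le_one₀ hpos.le (by linarith)
    _ = 2 * explicitSize θ k ^ 3 := by rw [mul_one]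

lemma two_mul_explicitSize_cube_le (h0 : 0 < θ) (hk : 1 ≤ k) :
    2 * explicitSize θ k ^ 3 ≤
      Δ θ * (explicit θ).a k / (2 * k * (explicit θ).γ k ^ (2 * (explicit θ).ε k)) := by
  have hpos := explicitSize_pos θ k
  have : (0 : ℝ) < k := by exact_mod_cast hk
  have hγ : 0 ≤ (explicit θ).γ k := (Real.exp_pos _).le
  calc 2 * explicitSize θ k ^ 3
      = explicitSize θ k * (4 * k) * explicitSize θ k ^ 2 / (2 * k) := by field_simp; ring
    _ ≤ Δ θ * explicitSize θ k ^ 2 / (2 * k) := by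
        gcongr
        exact explicitSize_mul_natCast_le θ k
    _ = Δ θ * (explicit θ).a k / (2 * k * (explicit θ).γ k ^ (2 * (explicit θ).ε k)) := by
        rw [← explicit_div_rpow h0, show (explicit θ).a k = 1 from rfl,
          mul_comm 2 ((explicit θ).ε k), Real.rpow_mul hγ, Real.rpow_two]
        field_simp

lemma pi_mul_explicit_ε (θ : ℝ) (k : ℕ) : π * (explicit θ).ε k = θ / 8 ^ k := by
  rw [explicit]
  field_simp

lemma one_le_explicit_rate (h0 : 0 < θ) (hθ : θ < π / 2) : 1 ≤ 4 / Δ θ * π / θ := by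
  have hΔ : 1 ≤ 4 / Δ θ := by
    rw [le_div_iff₀ (Δ_pos θ)]
    linarith [Δ_le_one θ]
  rw [le_div_iff₀ h0]
  nlinarith [Real.pi_pos]

lemma two_le_explicit_γ_one (h0 : 0 < θ) (hθ : θ < π / 2) : 2 ≤ (explicit θ).γ 1 := by
  have hrate := one_le_explicit_rate h0 hθ
  calc (2 : ℝ) ≤ 4 / Δ θ * π / θ * 64 ^ 1 + 1 := by linarith
    _ ≤ (explicit θ).γ 1 := Real.add_one_le_exp _

lemma explicit_γ_sq_lt (h0 : 0 < θ) (k : ℕ) : (explicit θ).γ k ^ 2 < (explicit θ).γ (k + 1) := by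
  have hΔ := Δ_pos θ
  have hexponent : 0 < 4 / Δ θ * π / θ * 64 ^ k := by have := Real.pi_pos; positivity
  rw [explicit, ← Real.exp_nat_mul, Real.exp_lt_exp, pow_succ]
  push_cast
  linarith

lemma admissible_explicit (h0 : 0 < θ) (hθ : θ < π / 2) : (explicit θ).Admissible θ where
  a_pos _ _ := one_pos
  γ_pos _ _ := Real.exp_pos _
  ε_pos _ _ := div_pos (div_pos h0 Real.pi_pos) (by positivity)
  ε_le k _ := by
    rw [pi_mul_explicit_ε]
    exact div_le_self h0.le (one_le_pow₀ (by norm_num))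
  ε_lim := (tendsto_pow_atTop_atTop_of_one_lt (by norm_num)).const_div_atTop _
  angle_even k _ := by
    rw [pi_mul_explicit_ε]
    simp only [explicit, (even_two_mul k).neg_one_pow]
    ring
  angle_odd k hk := by
    have hodd : Odd (2 * k - 1) := ⟨k - 1, by omega⟩
    rw [pi_mul_explicit_ε]
    simp only [explicit, hodd.neg_one_pow]
    ring
  step_summable := by
    simpa only [explicit_div_rpow h0, zero_add, add_comm] using summable_explicitSize θ 0
  step := by
    have hsum := tsum_explicitSize_le θ 0
    have hcube := pow_le_pow_left₀ (explicitSize_pos θ 0).le (explicitSize_le_quarter θ 0) 3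
    simp only [zero_add, add_comm 1] at hsum
    simp only [explicit_div_rpow h0]
    linarith [two_le_explicit_γ_one h0 hθ]
  γ_one := two_le_explicit_γ_one h0 hθ
  γ_growth k _ := explicit_γ_sq_lt h0 k
  head_le k hk := (sum_explicit_le h0 k).trans (two_mul_explicitSize_cube_le h0 hk)
  tail_le k hk := by
    simp only [explicit_div_rpow h0]
    exact (tsum_explicitSize_le θ k).trans (two_mul_explicitSize_cube_le h0 hk)

end SlopeCoeffs

lemma sub_div_two_lt_pi_div_two {a b : ℝ} (ha : 0 ≤ a) (hb : b ≤ π)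
    (hne : Set.Icc a b ≠ Set.Icc 0 π) : (b - a) / 2 < π / 2 := by
  by_contra! hle
  exact hne (by rw [show a = 0 by linarith, show b = π by linarith])

lemma arg_slopeRotation {a b : ℝ} (h : a + (b - a) / 2 ∈ Set.Ioc (-π) π) :
    (slopeRotation a b).arg = a + (b - a) / 2 := by
  rwa [slopeRotation, mul_comm, Complex.arg_exp_mul_I, toIocMod_eq_self,
    show -π + 2 * π = π by ring]

lemma isSectorAxis_slopeRotation {a b : ℝ} (ha : 0 ≤ a) (hab : a < b) (hb : b ≤ π) :
    IsSectorAxis ((b - a) / 2) (slopeRotation a b) where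
  norm_eq_one := by rw [slopeRotation, mul_comm, Complex.norm_exp_ofReal_mul_I]
  arg_mem := by
    rw [arg_slopeRotation ⟨by linarith [Real.pi_pos], by linarith⟩]
    constructor <;> linarith

theorem theorem2p4 (a b : ℝ) (ha : 0 ≤ a) (hab : a < b) (hb : b ≤ π)
    (hne : Set.Icc a b ≠ Set.Icc 0 π) :
    (∃ c : SlopeCoeffs, c.Admissible ((b - a) / 2)) ∧
    ∀ c : SlopeCoeffs, c.Admissible ((b - a) / 2) →
      (∀ z : ℍ, Summable fun k : ℕ =>
        c.term (k + 1) (starRingEnd ℂ (slopeRotation a b) * (z : ℂ))) ∧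
      ∃ f : ℍ → ℍ,
        (∀ z : ℍ, (f z : ℂ) =
          slopeRotation a b * c.F (starRingEnd ℂ (slopeRotation a b) * (z : ℂ))) ∧
        IsParabolicInfty f ∧
        HasZeroHyperbolicStep f ∧
        (∀ z : ℍ, slopeSet f z = Set.Icc a b) ∧
        ∃ z₀ : ℍ, (z₀ : ℂ) = slopeRotation a b * ((c.γ 1 / 2 : ℝ) : ℂ) ∧
          (∀ k : ℕ, 1 ≤ k → ∃ n : ℕ,
            c.γ k ^ 2 < (starRingEnd ℂ (slopeRotation a b) * ((f^[n] z₀ : ℍ) : ℂ)).re) ∧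
          StrictMonoOn (exitTime c (slopeRotation a b) f z₀) (Set.Ici 1) ∧
          Tendsto (fun k : ℕ => Complex.arg
            ((f^[exitTime c (slopeRotation a b) f z₀ (2 * k)] z₀ : ℍ) : ℂ)) atTop (𝓝 b) ∧
          Tendsto (fun k : ℕ => Complex.arg
            ((f^[exitTime c (slopeRotation a b) f z₀ (2 * k + 1)] z₀ : ℍ) : ℂ)) atTop (𝓝 a) := by
  have hθ := sub_div_two_lt_pi_div_two ha hb hne
  have hξ := isSectorAxis_slopeRotation ha hab hb
  have harg : (slopeRotation a b).arg = a + (b - a) / 2 :=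
    arg_slopeRotation ⟨by linarith [Real.pi_pos], by linarith⟩
  have hleft : (slopeRotation a b).arg - (b - a) / 2 = a := by linarith
  have hright : (slopeRotation a b).arg + (b - a) / 2 = b := by linarith
  refine ⟨⟨_, SlopeCoeffs.admissible_explicit (by linarith) hθ⟩, fun c h => ⟨fun z =>
    (h.hasSum_displacement hθ (hξ.dominated_conj_mul h.θ_pos c z)).summable,
    c.rotatedMap (slopeRotation a b), h.coe_rotatedMap hθ hξ, h.isParabolicInfty hθ hξ,
    h.hasZeroHyperbolicStep hθ hξ,
    fun z => by rw [h.slopeSet_rotatedMap hθ hξ, hleft, hright], ?_⟩⟩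
  have hγ := h.γ_one
  have him : 0 < (slopeRotation a b * ((c.γ 1 / 2 : ℝ) : ℂ)).im := by
    rw [Complex.im_mul_ofReal]
    exact mul_pos (hξ.im_pos h.θ_pos) (by linarith)
  have harg_exit := h.tendsto_arg_exitTime hθ hξ ⟨_, him⟩
  refine ⟨⟨_, him⟩, rfl, fun k _ => ⟨_, (h.isLeast_exitTime hθ hξ _ k).1⟩, ?_, ?_, ?_⟩
  · refine h.strictMonoOn_exitTime hθ hξ ?_ ?_ <;>
      rw [UpperHalfPlane.coe_mk, hξ.conj_mul_mul, Complex.ofReal_re] <;> nlinarith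
  · simpa only [hright] using tendsto_even_of_tendsto_neg_one_pow_mul_sub harg_exit
  · simpa only [hleft] using tendsto_odd_of_tendsto_neg_one_pow_mul_sub harg_exit
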